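/- Let $\mathbb K=\mathbb C$ or $\mathbb K=\mathbb R$, let $n\ge 3$ and let $r_1,\dots,r_n\in\mathbb K$ be distinct, $R=\mathrm{diag}(r_1,\dots,r_n)$. Consider the generalized Landau–Lifshitz system $$S_t=\Bigl(S_{xx}+\tfrac32\langle S_x,S_x\rangle S\Bigr)_x+\tfrac32\langle S,RS\rangle S_x,\qquad \langle S,S\rangle=1,\qquad S=(s^1,\dots,s^n).$$ The constraint is resolved by $s^i=\frac{2u^i}{1+\langle u,u\rangle}$ for $i<n$ and $s^n=\frac{1-\langle u,u\rangle}{1+\langle u,u\rangle}$, where $u=(u^1,\dots,u^{n-1})$. With $\Delta=1+\langle u,u\rangle$ this turns the system into the evolutionary system $u^i_t=F^i$, $i=1,\dots,n-1$, of order $3$ given by $$u_t=u_{xxx}-6\langle u,u_x\rangle\Delta^{-1}u_{xx}+\bigl(-6\langle u,u_{xx}\rangle\Delta^{-1}+24\langle u,u_x\rangle^2\Delta^{-2}-6\langle u,u\rangle\langle u_x,u_x\rangle\Delta^{-2}\bigr)u_x$$ $$\qquad+\bigl(6\langle u_x,u_{xx}\rangle\Delta^{-1}-12\langle u,u_x\rangle\langle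 u_x,u_x\rangle\Delta^{-2}\bigr)u+\tfrac32\Bigl(r_n+4\Delta^{-2}\sum_{i=1}^{n-1}(r_i-r_n)(u^i)^2\Bigr)u_x .$$ Write $u^i_k=\partial_x^k u^i$, $D_x=\sum_{i,k\ge0} u^i_{k+1}\,\partial/\partial u^i_k$ and $D_t=\sum_{i,k\ge0} D_x^k(F^i)\,\partial/\partial u^i_k$. Functions of the $u^i_k$ are expanded as formal power series in these variables. The Wahlquist–Estabrook (WE) algebra of the system is the Lie algebra over $\mathbb K$ with generators $A^\alpha,B^\beta$, where $U^\alpha,U^\beta$ run through the monomials in the variables $u^i_k$, $i\le n-1$, $k\le 2$, and with the relations which say that all the coefficients of $$D_x(T)-D_t(X)+[X,T],\qquad X=\sum_\alpha A^\alpha U^\alpha,\quad T=\sum_\beta B^\beta U^\beta,$$ vanish. A pair $(M,N)$ of series with coefficients in a Lie algebra $\mathfrak g$ is a $\mathfrak g$-valued zero-curvature representation (ZCR) of the system if $D_x(N)-D_t(M)+[M,N]=0$. Let $Q=\mathbb K[\lambda_1,\dots,\lambda_n]/(\lambda_i^2-\lambda_j^2+r_i-r_j)_{i,j}$, the algebra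 of polynomial functions on the curve $\lambda_i^2-\lambda_j^2=r_j-r_i$. Denote the image of $\lambda_i$ in $Q$ by $\bar\lambda_i$, and put $\bar\lambda=\bar\lambda_i^2+r_i$, which does not depend on $i$. Let $L(n)\subset\mathfrak{gl}_{n+1}(Q)$ be the Lie algebra over $\mathbb K$ generated by $Q_i=(E_{i,n+1}+E_{n+1,i})\otimes\bar\lambda_i$, $i=1,\dots,n$. Put $$M=\sum_{i=1}^n s^i\lambda_i(E_{i,n+1}+E_{n+1,i}),\qquad N=D_x^2(M)+[D_x(M),M]+(r_1+\lambda_1^2)M+\bigl(\tfrac12\langle S,RS\rangle+\tfrac32\langle S_x,S_x\rangle\bigr)M.$$ Then: 1. $L(n)\subset\mathfrak{so}_{n,1}\otimes Q$ is infinite-dimensional and quasigraded: $L(n)=\bigoplus_{i\ge1}\bar L_i$ with $[\bar L_i,\bar L_j]\subset\bar L_{i+j}+\bar L_{i+j-2}$ (where $\bar L_0=0$). For $k\ge1$, $\bar L_{2k-1}$ is spanned by the elements $(E_{i,n+1}+E_{n+1,i})\otimes\bar\lambda^{k-1}\bar\lambda_i$ and has dimension $n$, while $\bar L_{2k}$ is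 spanned by the elements $(E_{i,j}-E_{j,i})\otimes\bar\lambda^{k-1}\bar\lambda_i\bar\lambda_j$, $i<j$, and has dimension $n(n-1)/2$. 2. For every point $(\lambda_1,\dots,\lambda_n)\in\mathbb K^n$ of the curve, $(M,N)$ is an $\mathfrak{so}_{n,1}$-valued ZCR of the system. With $\lambda_i$ replaced by $\bar\lambda_i$, $(M,N)$ is an $L(n)$-valued ZCR of the system, and $M,N$ depend on $u,u_x,u_{xx}$ only. 3. There is a surjective Lie algebra homomorphism from the WE algebra of the system onto $L(n)$. It is given by $A^\alpha\mapsto M^\alpha$, $B^\beta\mapsto N^\beta$, where $M^\alpha,N^\beta\in L(n)$ are the coefficients of the power series $M,N$ of the $L(n)$-valued ZCR. -/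

import Mathlib

attribute [local instance 100] LieRing.ofAssociativeRing

noncomputable section

namespace WahlquistEstabrook

/-! ### Formal power series in the jet variables

The jet variable `u^i_k` (the `k`-th `x`-derivative of the `i`-th unknown function) is indexed by
the pair `(i, k) : Fin m × ℕ`. All the systems below are autonomous and all the series are
independent of `x` and `t`, so that these two coordinates do not appear. -/

/-- Formal power series in the jet variables `u^i_k` with coefficients in `V`: the coefficient
of `X` at the monomial `γ` is `X γ`. If `V` is a ring then this is Mathlib's ring of power series. -/
abbrev JetSeries (m : ℕ) (V : Type*) := MvPowerSeries (Fin m × ℕ) V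

/-- The coefficient of a power series with arbitrary coefficients (for `V` a ring, this is
`MvPowerSeries.coeff`). -/
def coef {m : ℕ} {V : Type*} (γ : (Fin m × ℕ) →₀ ℕ) (X : JetSeries m V) : V := X γ

/-- The variable `u^i_k`. -/
def jet (K : Type*) [Field K] {m : ℕ} (i : Fin m) (k : ℕ) : JetSeries m K :=
  MvPowerSeries.X (i, k)

/-- The product `f • X` of a scalar series and a `V`-valued series. -/
def scale {K V : Type*} [Field K] [AddCommGroup V] [Module K V] {m : ℕ}
    (f : JetSeries m K) (X : JetSeries m V) : JetSeries m V :=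
  fun γ => ∑ p ∈ Finset.HasAntidiagonal.antidiagonal γ, coef p.1 f • coef p.2 X

/-- The bracket of two series with coefficients in a Lie algebra,
`[X, T] = ∑ [A^α, B^β] U^α U^β`. -/
def bracket {V : Type*} [LieRing V] {m : ℕ} (X T : JetSeries m V) : JetSeries m V :=
  fun γ => ∑ p ∈ Finset.HasAntidiagonal.antidiagonal γ, ⁅coef p.1 X, coef p.2 T⁆

/-- The partial derivative `∂X/∂u^i_k`, where `s = (i, k)`. -/
def partialD {V : Type*} [AddCommGroup V] {m : ℕ} (s : Fin m × ℕ) (X : JetSeries m V) :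
    JetSeries m V :=
  fun γ => (γ s + 1) • coef (γ + Finsupp.single s 1) X

/-- The total derivative `D_x = ∑ u^i_{k+1} ∂/∂u^i_k`. In every degree only finitely many
summands are nonzero, since a monomial contains only finitely many variables. -/
def totalDx (K : Type*) {V : Type*} [Field K] [AddCommGroup V] [Module K V] {m : ℕ}
    (X : JetSeries m V) : JetSeries m V :=
  fun γ => ∑ᶠ s : Fin m × ℕ, coef γ (scale (jet K s.1 (s.2 + 1)) (partialD s X))

/-- The total derivative `D_t = ∑ D_x^k(F^i) ∂/∂u^i_k` along the evolutionary system
`u^i_t = F^i`. It is applied to series `X` in finitely many variables only, for which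
the sum has finitely many nonzero summands. -/
def totalDt {K V : Type*} [Field K] [AddCommGroup V] [Module K V] {m : ℕ}
    (F : Fin m → JetSeries m K) (X : JetSeries m V) : JetSeries m V :=
  fun γ => ∑ᶠ s : Fin m × ℕ, coef γ (scale ((totalDx K)^[s.2] (F s.1)) (partialD s X))

/-- The curvature `[D_x + X, D_t + T] = D_x(T) - D_t(X) + [X, T]`. -/
def curvature {K V : Type*} [Field K] [LieRing V] [LieAlgebra K V] {m : ℕ}
    (F : Fin m → JetSeries m K) (X T : JetSeries m V) : JetSeries m V :=
  totalDx K T - totalDt F X + bracket X T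

/-- The set `𝓜` of the exponents of the monomials `U^α` in the variables `u^i_k`, `k ≤ d - 1`. -/
def Exponents (m d : ℕ) : Set ((Fin m × ℕ) →₀ ℕ) := {α | ∀ s ∈ α.support, s.2 < d}

/-- The series `X` depends on the variables `u^i_k`, `k ≤ d - 1`, only. -/
def DependsOnlyBelow {V : Type*} [Zero V] {m : ℕ} (d : ℕ) (X : JetSeries m V) : Prop :=
  ∀ γ, γ ∉ Exponents m d → coef γ X = 0

open scoped Classical in
/-- The series `∑_{α ∈ 𝓜} A^α U^α`. -/
def seriesOf {V : Type*} [Zero V] {m d : ℕ} (A : Exponents m d → V) : JetSeries m V :=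
  fun γ => if h : γ ∈ Exponents m d then A ⟨γ, h⟩ else 0

/-- The free Lie algebra on the letters `A^α` (left) and `B^β` (right), `α, β ∈ 𝓜`. -/
abbrev FreeAlg (K : Type*) [Field K] (m d : ℕ) :=
  FreeLieAlgebra K (Exponents m d ⊕ Exponents m d)

/-- The ideal generated by the coefficients of `[D_x + X, D_t + T]`, where `X = ∑ A^α U^α` and
`T = ∑ B^β U^β`. -/
def relationIdeal {K : Type*} [Field K] {m : ℕ} (d : ℕ) (F : Fin m → JetSeries m K) :
    LieIdeal K (FreeAlg K m d) :=
  LieSubmodule.lieSpan K (FreeAlg K m d) (Set.range fun γ =>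
    coef γ (curvature F
      (seriesOf fun α : Exponents m d => FreeLieAlgebra.of K (Sum.inl α))
      (seriesOf fun β : Exponents m d => FreeLieAlgebra.of K (Sum.inr β))))

/-- The Wahlquist-Estabrook algebra of the evolutionary system `u^i_t = F^i` of order `d`. -/
abbrev WEAlgebra {K : Type*} [Field K] {m : ℕ} (d : ℕ) (F : Fin m → JetSeries m K) :=
  FreeAlg K m d ⧸ relationIdeal d F

/-- The generator `A^α` of the Wahlquist-Estabrook algebra. -/
def genA {K : Type*} [Field K] {m d : ℕ} (F : Fin m → JetSeries m K) (α : Exponents m d) :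
    WEAlgebra d F :=
  LieSubmodule.Quotient.mk (FreeLieAlgebra.of K (Sum.inl α))

/-- The generator `B^β` of the Wahlquist-Estabrook algebra. -/
def genB {K : Type*} [Field K] {m d : ℕ} (F : Fin m → JetSeries m K) (β : Exponents m d) :
    WEAlgebra d F :=
  LieSubmodule.Quotient.mk (FreeLieAlgebra.of K (Sum.inr β))

end WahlquistEstabrook

namespace LandauLifshitz

open WahlquistEstabrook

/-! ### The generalized Landau-Lifshitz system, with `n = m + 1` -/

section System

variable {K : Type*} [Field K] {m : ℕ}

/-- The standard scalar product of two vectors of power series. -/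
def dot {l : ℕ} (a b : Fin l → JetSeries m K) : JetSeries m K := ∑ i, a i * b i

/-- The vector `∂^k u / ∂x^k = (u^1_k, …, u^{n-1}_k)`. -/
def uVec (K : Type*) [Field K] (m k : ℕ) : Fin m → JetSeries m K := fun i => jet K i k

/-- `Δ⁻¹`, where `Δ = 1 + ⟨u, u⟩`. -/
def deltaInv (K : Type*) [Field K] (m : ℕ) : JetSeries m K :=
  (1 + dot (uVec K m 0) (uVec K m 0))⁻¹

/-- The vector `S` of the unit sphere in the coordinates `u`:
`s^i = 2 u^i / (1 + ⟨u, u⟩)` for `i < n` and `s^n = (1 - ⟨u, u⟩) / (1 + ⟨u, u⟩)`. -/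
def sphereVec (K : Type*) [Field K] (m : ℕ) : Fin (m + 1) → JetSeries m K :=
  Fin.snoc (α := fun _ => JetSeries m K)
    (fun i => 2 * uVec K m 0 i * deltaInv K m)
    ((1 - dot (uVec K m 0) (uVec K m 0)) * deltaInv K m)

/-- The vector `S_x`. -/
def sphereVecX (K : Type*) [Field K] (m : ℕ) : Fin (m + 1) → JetSeries m K :=
  fun i => totalDx K (sphereVec K m i)

/-- The function `⟨S, R S⟩`, where `R = diag(r_1, …, r_n)`. -/
def sphereQuad (r : Fin (m + 1) → K) : JetSeries m K :=
  dot (sphereVec K m) (fun i => r i • sphereVec K m i)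

/-- The right-hand side of the generalized Landau-Lifshitz system for `S`,
`(S_xx + (3/2)⟨S_x, S_x⟩ S)_x + (3/2)⟨S, R S⟩ S_x`. -/
def sphereRHS (r : Fin (m + 1) → K) (i : Fin (m + 1)) : JetSeries m K :=
  totalDx K (totalDx K (sphereVecX K m i)
      + (3 / 2 : K) • (dot (sphereVecX K m) (sphereVecX K m) * sphereVec K m i))
    + (3 / 2 : K) • (sphereQuad r * sphereVecX K m i)

/-- The right-hand sides `F^i` of the generalized Landau-Lifshitz system, written as an
evolutionary system of order `3` for `u = (u^1, …, u^{n-1})` and expanded in power series. -/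
def rhs (r : Fin (m + 1) → K) (i : Fin m) : JetSeries m K :=
  let u := uVec K m 0
  let u₁ := uVec K m 1
  let u₂ := uVec K m 2
  let u₃ := uVec K m 3
  let D := deltaInv K m
  u₃ i - 6 * dot u u₁ * D * u₂ i
    + (-6 * dot u u₂ * D + 24 * dot u u₁ ^ 2 * D ^ 2 - 6 * dot u u * dot u₁ u₁ * D ^ 2) * u₁ i
    + (6 * dot u₁ u₂ * D - 12 * dot u u₁ * dot u₁ u₁ * D ^ 2) * u i
    + (3 / 2 : K) • ((MvPowerSeries.C (r (Fin.last m))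
        + 4 * D ^ 2 * ∑ j : Fin m, (r j.castSucc - r (Fin.last m)) • u j ^ 2) * u₁ i)

end System

/-! ### The zero-curvature representation -/

section ZCR

/-- Square matrices of size `n + 1`; the last index is `Sum.inr ()`. -/
abbrev Mat (n : ℕ) (A : Type*) := Matrix (Fin n ⊕ Unit) (Fin n ⊕ Unit) A

/-- `(E_{i,n+1} + E_{n+1,i}) ⊗ q`. -/
def boost {n : ℕ} {A : Type*} [CommRing A] (i : Fin n) (q : A) : Mat n A :=
  Matrix.single (Sum.inl i) (Sum.inr ()) q + Matrix.single (Sum.inr ()) (Sum.inl i) q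

/-- `(E_{i,j} - E_{j,i}) ⊗ q`. -/
def rotation {n : ℕ} {A : Type*} [CommRing A] (i j : Fin n) (q : A) : Mat n A :=
  Matrix.single (Sum.inl i) (Sum.inl j) q - Matrix.single (Sum.inl j) (Sum.inl i) q

/-- The equations `λ_i² - λ_j² = r_j - r_i` of the curve, for elements `λ_i` of a commutative
algebra. -/
def OnCurve {K A : Type*} [Field K] [CommRing A] [Algebra K A] {n : ℕ}
    (r : Fin n → K) (l : Fin n → A) : Prop :=
  ∀ i j, l i ^ 2 - l j ^ 2 = algebraMap K A (r j - r i)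

variable {K A : Type*} [Field K] [CommRing A] [Algebra K A] {m : ℕ}

/-- `M = ∑ s^i λ_i (E_{i,n+1} + E_{n+1,i})`. -/
def zcrM (K : Type*) [Field K] [Algebra K A] (l : Fin (m + 1) → A) :
    JetSeries m (Mat (m + 1) A) :=
  fun γ => ∑ i, coef γ (sphereVec K m i) • boost i (l i)

/-- `N = D_x²(M) + [D_x(M), M] + (r_1 + λ_1²) M + ((1/2)⟨S, R S⟩ + (3/2)⟨S_x, S_x⟩) M`. -/
def zcrN (r : Fin (m + 1) → K) (l : Fin (m + 1) → A) : JetSeries m (Mat (m + 1) A) :=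
  totalDx K (totalDx K (zcrM K l)) + bracket (totalDx K (zcrM K l)) (zcrM K l)
    + (algebraMap K A (r 0) + l 0 ^ 2) • zcrM K l
    + scale ((1 / 2 : K) • sphereQuad r
        + (3 / 2 : K) • dot (sphereVecX K m) (sphereVecX K m)) (zcrM K l)

end ZCR

/-! ### The algebra `L(n)` -/

section Curve

variable {K : Type*} [Field K] {n : ℕ}

/-- The ideal of the curve, generated by the polynomials `λ_i² - λ_j² + r_i - r_j`. -/
def curveIdeal (r : Fin n → K) : Ideal (MvPolynomial (Fin n) K) :=
  Ideal.span (Set.range fun p : Fin n × Fin n =>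
    MvPolynomial.X p.1 ^ 2 - MvPolynomial.X p.2 ^ 2 + MvPolynomial.C (r p.1)
      - MvPolynomial.C (r p.2))

/-- The algebra `Q` of polynomial functions on the curve. -/
abbrev CurveRing (r : Fin n → K) := MvPolynomial (Fin n) K ⧸ curveIdeal r

/-- The coordinate function `λ_i` on the curve. -/
def coord (r : Fin n → K) (i : Fin n) : CurveRing r :=
  Ideal.Quotient.mk (curveIdeal r) (MvPolynomial.X i)

/-- The Lie subalgebra `L(n)` of `gl_{n+1}(Q)` over `K` generated by the elements
`Q_i = (E_{i,n+1} + E_{n+1,i}) ⊗ λ_i`. -/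
def algL (r : Fin n → K) : LieSubalgebra K (Mat n (CurveRing r)) :=
  LieSubalgebra.lieSpan K (Mat n (CurveRing r)) (Set.range fun i => boost i (coord r i))

/-- The function `λ = λ_i² + r_i` on the curve, which does not depend on `i`. -/
def spectral [NeZero n] (r : Fin n → K) : CurveRing r :=
  coord r 0 ^ 2 + algebraMap K (CurveRing r) (r 0)

/-- The components of the quasigrading: for `k ≥ 1`,
`L_{2k-1}` is spanned by the `Q^{2k-1}_i = (E_{i,n+1} + E_{n+1,i}) ⊗ λ^{k-1} λ_i`, and
`L_{2k}` by the `Q^{2k}_{ij} = (E_{i,j} - E_{j,i}) ⊗ λ^{k-1} λ_i λ_j` with `i < j`; `L_0 = 0`. -/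
def component [NeZero n] (r : Fin n → K) : ℕ → Submodule K (Mat n (CurveRing r))
  | 0 => ⊥
  | k + 1 =>
    if Even k then
      Submodule.span K (Set.range fun i => boost i (spectral r ^ (k / 2) * coord r i))
    else
      Submodule.span K {x | ∃ i j, i < j ∧
        x = rotation i j (spectral r ^ (k / 2) * coord r i * coord r j)}

end Curve

end LandauLifshitz

end

open WahlquistEstabrook LandauLifshitz

/-! Write v_i = λ_i s^i, q = ⟨S,RS⟩, p = ⟨S_x,S_x⟩, λ = λ_i² + r_i. The matrix M has the boost
entries v_i only; N has the boost entries v_i'' + P v_i with P = λ + q/2 + 3p/2, and the rotation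
entries v_i' v_j - v_j' v_i. The rotation entries of the curvature cancel identically. A boost entry
reduces to D_x(v_i'' + P v_i) - D_t v_i - v_i' ∑ v_k² + v_i ∑ v_k v_k'. The curve and ⟨S,S⟩ = 1 give
∑ v_k² = λ - q, hence ∑ v_k v_k' = -q'/2, and inserting the equation for S makes everything cancel
(`zcr_vector_identity`, `curvature_zcr`). That the system for u really is the equation for S is an
identity in a differential ring, modulo Δ⁻¹Δ = 1 (`derivation_stereographic`,
`totalDt_rhs_sphereVec`).

The structure of L(n) comes from the brackets of boosts and rotations together with λ_j² = λ - r_j: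
a contracted index j produces a factor λ_j², so that a bracket has a part of top degree and a part
two degrees lower (`lie_component_mem`). The same relation, solved for the top part, generates all
degrees from the Q_i (`oddElement_mem_algL`). Directness of the sum and the dimensions follow from
one fact: p(λ) λ_i λ_j = 0 in Q forces p = 0, by evaluation at curve points with prescribed λ
(`eq_zero_of_aeval_spectral_mul`, `linearIndependent_homogeneousElement`).

Finally, all operations in the curvature commute with applying a Lie homomorphism to coefficients,
so a ZCR in u, u_x, u_xx is the same as a homomorphism from the WE algebra (`exists_hom_of_zcr`). It
is onto because the coefficients of M at 1 and at u^j are Q_n and 2 Q_j, which generate L(n). -/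

noncomputable section

namespace WahlquistEstabrook

/-! ### Naturality of the operations on series in the coefficients -/

section Naturality

variable {K V W : Type*} [Field K] [AddCommGroup V] [Module K V] [AddCommGroup W] [Module K W]
  {m : ℕ}

@[ext] theorem JetSeries.ext_coef {V : Type*} {X Y : JetSeries m V}
    (h : ∀ γ, coef γ X = coef γ Y) : X = Y := funext h

theorem coef_add (γ : (Fin m × ℕ) →₀ ℕ) (X Y : JetSeries m V) :
    coef γ (X + Y) = coef γ X + coef γ Y := rfl

theorem coef_sub (γ : (Fin m × ℕ) →₀ ℕ) (X Y : JetSeries m V) :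
    coef γ (X - Y) = coef γ X - coef γ Y := rfl

theorem coef_zero (γ : (Fin m × ℕ) →₀ ℕ) : coef γ (0 : JetSeries m V) = 0 := rfl

/-- The series obtained by applying a linear map to all the coefficients. -/
def mapCoef (g : V →ₗ[K] W) (X : JetSeries m V) : JetSeries m W := fun γ => g (coef γ X)

theorem coef_mapCoef (g : V →ₗ[K] W) (X : JetSeries m V) (γ : (Fin m × ℕ) →₀ ℕ) :
    coef γ (mapCoef g X) = g (coef γ X) := rfl

theorem mapCoef_add (g : V →ₗ[K] W) (X Y : JetSeries m V) :
    mapCoef g (X + Y) = mapCoef g X + mapCoef g Y := by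
  ext γ; simp [coef_mapCoef, coef_add]

theorem mapCoef_sub (g : V →ₗ[K] W) (X Y : JetSeries m V) :
    mapCoef g (X - Y) = mapCoef g X - mapCoef g Y := by
  ext γ; simp [coef_mapCoef, coef_sub]

theorem scale_mapCoef (g : V →ₗ[K] W) (f : JetSeries m K) (X : JetSeries m V) :
    scale f (mapCoef g X) = mapCoef g (scale f X) := by
  ext γ
  simp only [coef_mapCoef]
  simp only [scale, coef, mapCoef, map_sum, map_smul]

theorem partialD_mapCoef (g : V →ₗ[K] W) (s : Fin m × ℕ) (X : JetSeries m V) :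
    partialD s (mapCoef g X) = mapCoef g (partialD s X) := by
  ext γ
  simp only [coef_mapCoef]
  simp only [partialD, coef, mapCoef, map_nsmul]

theorem coef_scale_jet_eq_zero (i : Fin m) (k : ℕ) (X : JetSeries m V)
    {γ : (Fin m × ℕ) →₀ ℕ} (h : γ (i, k) = 0) : coef γ (scale (jet K i k) X) = 0 := by
  refine Finset.sum_eq_zero fun p hp => ?_
  have hp' : p.1 + p.2 = γ := Finset.HasAntidiagonal.mem_antidiagonal.1 hp
  have : p.1 ≠ Finsupp.single (i, k) 1 := by
    rintro h1
    have := DFunLike.congr_fun hp' (i, k)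
    simp [h1, h] at this
  have h2 : coef p.1 (jet K i k) = 0 := by
    classical
    have := MvPowerSeries.coeff_X (R := K) p.1 (i, k)
    rw [if_neg ‹_›] at this
    exact this
  rw [h2, zero_smul]

/-- The indices `(i, k)` for which `u^i_{k+1}` occurs in the monomial `γ`. -/
def shiftedSupport (γ : (Fin m × ℕ) →₀ ℕ) : Finset (Fin m × ℕ) :=
  γ.support.image fun p => (p.1, p.2 - 1)

/-- A summand u^i_{k+1} ∂/∂u^i_k reaches the monomial γ only if u^i_{k+1} divides γ. Any larger
index set `T` is allowed, so that several monomials can share one finite sum. -/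
theorem coef_totalDx (X : JetSeries m V) (γ : (Fin m × ℕ) →₀ ℕ) {T : Finset (Fin m × ℕ)}
    (hT : shiftedSupport γ ⊆ T) :
    coef γ (totalDx K X) = ∑ s ∈ T, coef γ (scale (jet K s.1 (s.2 + 1)) (partialD s X)) := by
  refine finsum_eq_sum_of_support_subset _ fun s hs => hT ?_
  rw [Function.mem_support] at hs
  refine Finset.mem_image.2 ⟨(s.1, s.2 + 1), ?_, rfl⟩
  rw [Finsupp.mem_support_iff]
  exact fun h => hs (coef_scale_jet_eq_zero _ _ _ h)

theorem totalDx_mapCoef (g : V →ₗ[K] W) (X : JetSeries m V) :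
    totalDx K (mapCoef g X) = mapCoef g (totalDx K X) := by
  ext γ
  rw [coef_mapCoef, coef_totalDx _ _ subset_rfl, coef_totalDx _ _ subset_rfl, map_sum]
  simp only [partialD_mapCoef, scale_mapCoef, coef_mapCoef]

theorem scale_zero (f : JetSeries m K) : scale f (0 : JetSeries m V) = 0 := by
  ext γ
  exact Finset.sum_eq_zero fun p _ => by rw [coef_zero, smul_zero]

theorem partialD_eq_zero {d : ℕ} {X : JetSeries m V} (hX : DependsOnlyBelow d X)
    {s : Fin m × ℕ} (hs : d ≤ s.2) : partialD s X = 0 := by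
  ext γ
  have : coef (γ + Finsupp.single s 1) X = 0 := by
    refine hX _ fun h => absurd (h s ?_) (not_lt.2 hs)
    simp
  rw [coef_zero]
  simp only [coef, partialD] at *
  rw [this, smul_zero]

/-- The partial derivatives of order at least `d` vanish, which turns the formal infinite sum into a
finite one; linear maps can then be moved through D_t. -/
theorem coef_totalDt {d : ℕ} (F : Fin m → JetSeries m K) {X : JetSeries m V}
    (hX : DependsOnlyBelow d X) (γ : (Fin m × ℕ) →₀ ℕ) :
    coef γ (totalDt F X) = ∑ s ∈ (Finset.univ : Finset (Fin m)) ×ˢ Finset.range d,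
      coef γ (scale ((totalDx K)^[s.2] (F s.1)) (partialD s X)) := by
  refine finsum_eq_sum_of_support_subset _ fun s hs => ?_
  rw [Function.mem_support] at hs
  simp only [Finset.coe_product, Set.mem_prod, Finset.coe_univ, Set.mem_univ, Finset.coe_range,
    Set.mem_Iio, true_and]
  by_contra h
  exact hs (by rw [partialD_eq_zero hX (not_lt.1 h), scale_zero]; rfl)

theorem DependsOnlyBelow.mapCoef {d : ℕ} {X : JetSeries m V} (hX : DependsOnlyBelow d X)
    (g : V →ₗ[K] W) : DependsOnlyBelow d (mapCoef g X) := fun γ hγ => by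
  rw [coef_mapCoef, hX γ hγ, map_zero]

theorem totalDt_mapCoef {d : ℕ} (F : Fin m → JetSeries m K) (g : V →ₗ[K] W) {X : JetSeries m V}
    (hX : DependsOnlyBelow d X) : totalDt F (mapCoef g X) = mapCoef g (totalDt F X) := by
  ext γ
  rw [coef_mapCoef, coef_totalDt F hX, coef_totalDt F (hX.mapCoef g), map_sum]
  simp only [partialD_mapCoef, scale_mapCoef, coef_mapCoef]

end Naturality

section Lie

variable {K V W : Type*} [Field K] [LieRing V] [LieAlgebra K V] [LieRing W] [LieAlgebra K W]
  {m : ℕ}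

theorem bracket_mapCoef (g : V →ₗ⁅K⁆ W) (X T : JetSeries m V) :
    bracket (mapCoef (g : V →ₗ[K] W) X) (mapCoef (g : V →ₗ[K] W) T)
      = mapCoef (g : V →ₗ[K] W) (bracket X T) := by
  ext γ
  simp only [coef_mapCoef]
  simp only [bracket, coef, mapCoef, map_sum, LieHom.coe_toLinearMap, LieHom.map_lie]

/-- This is what makes the WE algebra universal: a homomorphism carries the curvature of the generic
pair to the curvature of its image. -/
theorem curvature_mapCoef {d : ℕ} (F : Fin m → JetSeries m K) (g : V →ₗ⁅K⁆ W)
    {X : JetSeries m V} (hX : DependsOnlyBelow d X) (T : JetSeries m V) :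
    curvature F (mapCoef (g : V →ₗ[K] W) X) (mapCoef (g : V →ₗ[K] W) T)
      = mapCoef (g : V →ₗ[K] W) (curvature F X T) := by
  simp only [curvature, totalDx_mapCoef, totalDt_mapCoef F _ hX, bracket_mapCoef, mapCoef_add,
    mapCoef_sub]

end Lie

/-! ### Bounds on the order of the jet variables -/

section Dependence

variable {K V : Type*} [Field K] [AddCommGroup V] [Module K V] {m d : ℕ}

theorem mem_exponents_add {p q : (Fin m × ℕ) →₀ ℕ} (hp : p ∈ Exponents m d)
    (hq : q ∈ Exponents m d) : p + q ∈ Exponents m d := by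
  classical
  intro s hs
  rcases Finset.mem_union.1 (Finsupp.support_add hs) with h | h
  exacts [hp s h, hq s h]

theorem DependsOnlyBelow.add {X Y : JetSeries m V} (hX : DependsOnlyBelow d X)
    (hY : DependsOnlyBelow d Y) : DependsOnlyBelow d (X + Y) := fun γ hγ => by
  rw [coef_add, hX γ hγ, hY γ hγ, add_zero]

theorem DependsOnlyBelow.mono {e : ℕ} (h : d ≤ e) {X : JetSeries m V}
    (hX : DependsOnlyBelow d X) : DependsOnlyBelow e X :=
  fun γ hγ => hX γ fun h' => hγ fun s hs => (h' s hs).trans_le h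

theorem DependsOnlyBelow.scale {f : JetSeries m K} {X : JetSeries m V}
    (hf : DependsOnlyBelow d f) (hX : DependsOnlyBelow d X) : DependsOnlyBelow d (scale f X) := by
  refine fun γ hγ => Finset.sum_eq_zero fun p hp => ?_
  by_cases h1 : p.1 ∈ Exponents m d
  · by_cases h2 : p.2 ∈ Exponents m d
    · exact absurd (Finset.HasAntidiagonal.mem_antidiagonal.1 hp ▸ mem_exponents_add h1 h2) hγ
    · rw [hX _ h2, smul_zero]
  · rw [hf _ h1, zero_smul]

theorem DependsOnlyBelow.bracket {V : Type*} [LieRing V] {X T : JetSeries m V}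
    (hX : DependsOnlyBelow d X) (hT : DependsOnlyBelow d T) :
    DependsOnlyBelow d (bracket X T) := by
  refine fun γ hγ => Finset.sum_eq_zero fun p hp => ?_
  by_cases h1 : p.1 ∈ Exponents m d
  · by_cases h2 : p.2 ∈ Exponents m d
    · exact absurd (Finset.HasAntidiagonal.mem_antidiagonal.1 hp ▸ mem_exponents_add h1 h2) hγ
    · rw [hT _ h2, lie_zero]
  · rw [hX _ h1, zero_lie]

theorem dependsOnlyBelow_jet (i : Fin m) {k : ℕ} (hk : k < d) :
    DependsOnlyBelow d (jet K i k) := by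
  classical
  intro γ hγ
  have := MvPowerSeries.coeff_X (R := K) γ (i, k)
  rw [if_neg] at this
  · exact this
  · rintro rfl
    refine hγ fun s hs => ?_
    rw [Finsupp.mem_support_iff, Finsupp.single_apply_ne_zero] at hs
    rw [hs.1]
    exact hk

theorem DependsOnlyBelow.partialD {X : JetSeries m V} (hX : DependsOnlyBelow d X)
    (s : Fin m × ℕ) : DependsOnlyBelow d (partialD s X) := by
  intro γ hγ
  have : coef (γ + Finsupp.single s 1) X = 0 :=
    hX _ fun h => hγ fun t ht => h t (by
      rw [Finsupp.mem_support_iff] at ht ⊢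
      rw [Finsupp.add_apply]
      omega)
  change _ • _ = _
  rw [this, smul_zero]

theorem DependsOnlyBelow.totalDx {X : JetSeries m V} (hX : DependsOnlyBelow d X) :
    DependsOnlyBelow (d + 1) (totalDx K X) := by
  intro γ hγ
  rw [coef_totalDx _ _ subset_rfl]
  refine Finset.sum_eq_zero fun s _ => ?_
  rcases lt_or_ge s.2 d with h | h
  · exact DependsOnlyBelow.scale (dependsOnlyBelow_jet _ (by omega))
      ((hX.partialD s).mono d.le_succ) γ hγ
  · rw [partialD_eq_zero hX h, scale_zero, coef_zero]

end Dependence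

/-! ### Series with coefficients in a subspace or a Lie subalgebra -/

section Membership

variable {K V : Type*} [Field K] {m : ℕ}

theorem coef_scale_mem [AddCommGroup V] [Module K V] (L : Submodule K V) (f : JetSeries m K)
    {X : JetSeries m V} (hX : ∀ γ, coef γ X ∈ L) (γ : (Fin m × ℕ) →₀ ℕ) :
    coef γ (scale f X) ∈ L :=
  L.sum_mem fun _ _ => L.smul_mem _ (hX _)

theorem coef_totalDx_mem [AddCommGroup V] [Module K V] (L : Submodule K V)
    {X : JetSeries m V} (hX : ∀ γ, coef γ X ∈ L) (γ : (Fin m × ℕ) →₀ ℕ) :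
    coef γ (totalDx K X) ∈ L := by
  rw [coef_totalDx _ _ subset_rfl]
  exact L.sum_mem fun s _ => coef_scale_mem L _ (fun γ => L.nsmul_mem (hX _) _) γ

theorem coef_bracket_mem [LieRing V] [LieAlgebra K V] (L : LieSubalgebra K V)
    {X T : JetSeries m V} (hX : ∀ γ, coef γ X ∈ L) (hT : ∀ γ, coef γ T ∈ L)
    (γ : (Fin m × ℕ) →₀ ℕ) : coef γ (bracket X T) ∈ L :=
  sum_mem fun _ _ => L.lie_mem (hX _) (hT _)

end Membership

/-! ### The total derivative as a derivation of power series -/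

section Derivation

variable {K A : Type*} [Field K] [CommRing A] [Algebra K A] {m : ℕ}

theorem coef_eq_coeff (γ : (Fin m × ℕ) →₀ ℕ) (X : JetSeries m A) :
    coef γ X = MvPowerSeries.coeff γ X := rfl

theorem scale_eq_map_mul (f : JetSeries m K) (X : JetSeries m A) :
    scale f X = MvPowerSeries.map (algebraMap K A) f * X := by
  ext γ
  rw [coef_eq_coeff, coef_eq_coeff, MvPowerSeries.coeff_mul]
  exact Finset.sum_congr rfl fun p _ => Algebra.smul_def _ _

theorem map_jet (i : Fin m) (k : ℕ) :
    MvPowerSeries.map (algebraMap K A) (jet K i k) = MvPowerSeries.X (i, k) :=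
  MvPowerSeries.map_X _ _

theorem partialD_eq_pderiv (s : Fin m × ℕ) (X : JetSeries m A) :
    partialD s X = MvPowerSeries.pderiv A s X := by
  ext γ
  rw [coef_eq_coeff _ (MvPowerSeries.pderiv A s X), MvPowerSeries.coeff_pderiv, mul_comm]
  change _ • _ = _
  rw [nsmul_eq_mul]
  push_cast
  rfl

theorem coeff_totalDx (X : JetSeries m A) (γ : (Fin m × ℕ) →₀ ℕ) {T : Finset (Fin m × ℕ)}
    (hT : shiftedSupport γ ⊆ T) :
    MvPowerSeries.coeff γ (totalDx K X) = MvPowerSeries.coeff γ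
      (∑ s ∈ T, MvPowerSeries.X (s.1, s.2 + 1) * MvPowerSeries.pderiv A s X) := by
  rw [map_sum]
  refine (coef_totalDx X γ hT).trans (Finset.sum_congr rfl fun s _ => ?_)
  rw [scale_eq_map_mul, map_jet, partialD_eq_pderiv]
  rfl

theorem shiftedSupport_mono {p γ : (Fin m × ℕ) →₀ ℕ} (h : p ≤ γ) :
    shiftedSupport p ⊆ shiftedSupport γ :=
  Finset.image_subset_image (Finsupp.support_mono h)

/-- Every monomial of the second factor that contributes to γ divides γ, so one finite sum of
derivations, depending on γ only, can stand for D_x. This gives the Leibniz rule coefficient by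
coefficient. -/
theorem coeff_totalDx_mul (X Y : JetSeries m A) (γ : (Fin m × ℕ) →₀ ℕ) :
    MvPowerSeries.coeff γ (Y * totalDx K X) = MvPowerSeries.coeff γ
      (Y * ∑ s ∈ shiftedSupport γ, MvPowerSeries.X (s.1, s.2 + 1) * MvPowerSeries.pderiv A s X) := by
  classical
  rw [MvPowerSeries.coeff_mul, MvPowerSeries.coeff_mul]
  refine Finset.sum_congr rfl fun p hp => ?_
  rw [coeff_totalDx X p.2 (shiftedSupport_mono (γ := γ)
    (Finset.HasAntidiagonal.mem_antidiagonal.1 hp ▸ self_le_add_left _ _))]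

/-- The total derivative `D_x` as a derivation of the algebra of power series. -/
def totalDxDerivation (K A : Type*) [Field K] [CommRing A] [Algebra K A] (m : ℕ) :
    Derivation A (JetSeries m A) (JetSeries m A) :=
  Derivation.mk'
    { toFun := totalDx K
      map_add' := fun X Y => by
        refine MvPowerSeries.ext fun γ => ?_
        rw [map_add]
        simp only [coeff_totalDx _ γ subset_rfl, map_add, mul_add, Finset.sum_add_distrib]
      map_smul' := fun a X => by
        refine MvPowerSeries.ext fun γ => ?_
        rw [RingHom.id_apply, map_smul]
        simp only [coeff_totalDx _ γ subset_rfl, Derivation.map_smul, mul_smul_comm,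
          ← Finset.smul_sum, map_smul] }
    fun X Y => by
      refine MvPowerSeries.ext fun γ => ?_
      simp only [LinearMap.coe_mk, AddHom.coe_mk, smul_eq_mul, map_add]
      rw [coeff_totalDx_mul, coeff_totalDx_mul, coeff_totalDx _ γ subset_rfl, ← map_add]
      congr 1
      simp only [Derivation.leibniz, smul_eq_mul, Finset.mul_sum, ← Finset.sum_add_distrib]
      exact Finset.sum_congr rfl fun s _ => by ring

theorem totalDxDerivation_apply (X : JetSeries m A) :
    totalDxDerivation K A m X = totalDx K X := rfl

theorem totalDx_X (i : Fin m) (k : ℕ) :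
    totalDx K (MvPowerSeries.X (i, k) : JetSeries m A) = MvPowerSeries.X (i, k + 1) := by
  classical
  refine MvPowerSeries.ext fun γ => ?_
  rw [coeff_totalDx _ γ (Finset.subset_insert (i, k) _),
    Finset.sum_eq_single_of_mem (i, k) (Finset.mem_insert_self _ _)]
  · simp
  · intro s _ hs
    rw [MvPowerSeries.pderiv_X_of_ne hs.symm, mul_zero]

end Derivation

end WahlquistEstabrook

namespace LandauLifshitz

/-! ### Stereographic coordinates in an abstract differential ring -/

section Differential

variable {k R : Type*} [CommRing k] [CommRing R] [Algebra k R] (D : Derivation k R R)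

theorem derivation_two : D 2 = 0 := by
  have := D.map_natCast 2
  exact_mod_cast this

/-- The evolution of a coordinate `2 w d` of the stereographic parametrization, where
`d = 1 / (1 + a)`, `a = ⟨u, u⟩`, `b = ⟨u, u_x⟩`, `c = ⟨u_x, u_x⟩`, `e = ⟨u, u_xx⟩`,
`f = ⟨u_x, u_xx⟩` and `g = ⟨u, u_xxx⟩`. -/
theorem derivation_stereographic {w w1 w2 w3 a b c e f g d C ρ F h : R}
    (hd : d * (1 + a) = 1) (hC : 2 * C = 3) (hDC : D C = 0)
    (Dw : D w = w1) (Dw1 : D w1 = w2) (Dw2 : D w2 = w3)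
    (Db : D b = c + e) (Dc : D c = 2 * f) (De : D e = f + g) (Dd : D d = -2 * b * d ^ 2)
    (hF : F = w3 - 6 * b * d * w2 + (-6 * e * d + 24 * b ^ 2 * d ^ 2 - 6 * a * c * d ^ 2) * w1
      + (6 * f * d - 12 * b * c * d ^ 2) * w + C * (ρ * w1))
    (hh : h = g - 6 * b * d * e + (-6 * e * d + 24 * b ^ 2 * d ^ 2 - 6 * a * c * d ^ 2) * b
      + (6 * f * d - 12 * b * c * d ^ 2) * a + C * (ρ * b)) :
    2 * F * d + 2 * w * (-2 * h * d ^ 2)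
      = D (D (D (2 * w * d)) + C * (4 * c * d ^ 2 * (2 * w * d))) + C * (ρ * D (2 * w * d)) := by
  have D2 := derivation_two D
  have D4 : D 4 = 0 := by exact_mod_cast D.map_natCast 4
  have s1 : D (2 * w * d) = 2 * w1 * d - 4 * b * d ^ 2 * w := by
    simp only [Derivation.leibniz, smul_eq_mul, Dw, Dd, D2]
    ring
  -- The first derivative is free of a, so no rule for D a is needed; a enters only through F and h,
  -- and is eliminated at the end by d(1 + a) = 1.
  rw [s1]
  simp only [Derivation.leibniz, Derivation.leibniz_pow, smul_eq_mul, nsmul_eq_mul, map_add,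
    map_sub, map_neg, Dw, Dw1, Dw2, Db, Dc, De, Dd, D2, D4, hDC, hF, hh]
  clear hF hh hDC Dw Dw1 Dw2 Db Dc De Dd D4 s1
  push_cast
  grind

/-- The companion identity for s^n = 2d - 1, whose time derivative needs only d_t = -2 h d² with h =
⟨u, F⟩. -/
theorem derivation_stereographic_last {a b c e f g d C ρ h : R}
    (hd : d * (1 + a) = 1) (hC : 2 * C = 3) (hDC : D C = 0)
    (Db : D b = c + e) (Dc : D c = 2 * f) (De : D e = f + g) (Dd : D d = -2 * b * d ^ 2)
    (hh : h = g - 6 * b * d * e + (-6 * e * d + 24 * b ^ 2 * d ^ 2 - 6 * a * c * d ^ 2) * b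
      + (6 * f * d - 12 * b * c * d ^ 2) * a + C * (ρ * b)) :
    2 * (-2 * h * d ^ 2)
      = D (D (D (2 * d - 1)) + C * (4 * c * d ^ 2 * (2 * d - 1))) + C * (ρ * D (2 * d - 1)) := by
  have D2 := derivation_two D
  have D4 : D 4 = 0 := by exact_mod_cast D.map_natCast 4
  have s1 : D (2 * d - 1) = - 4 * b * d ^ 2 := by
    simp only [Derivation.leibniz, smul_eq_mul, map_sub, Dd, D2, Derivation.map_one_eq_zero]
    ring
  rw [s1]
  simp only [Derivation.leibniz, Derivation.leibniz_pow, smul_eq_mul, nsmul_eq_mul, map_add,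
    map_sub, map_neg, Db, Dc, De, Dd, D2, D4, hDC, hh, Derivation.map_one_eq_zero]
  clear hh hDC Db Dc De Dd D4 s1
  push_cast
  grind

end Differential

/-! ### The system for u is the Landau–Lifshitz system for S -/

section Sphere

variable {K : Type*} [Field K] {m : ℕ}

theorem constantCoeff_dot_uVec :
    MvPowerSeries.constantCoeff (1 + dot (uVec K m 0) (uVec K m 0)) = 1 := by
  simp [dot, uVec, jet]

theorem deltaInv_mul : deltaInv K m * (1 + dot (uVec K m 0) (uVec K m 0)) = 1 :=
  MvPowerSeries.inv_mul_cancel _ (by rw [constantCoeff_dot_uVec]; exact one_ne_zero)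

theorem dot_comm {l : ℕ} (a b : Fin l → JetSeries m K) : dot a b = dot b a :=
  Finset.sum_congr rfl fun _ _ => mul_comm _ _

theorem derivation_dot (D : Derivation K (JetSeries m K) (JetSeries m K)) {l : ℕ}
    (a b : Fin l → JetSeries m K) :
    D (dot a b) = dot (fun i => D (a i)) b + dot a fun i => D (b i) := by
  simp only [dot, map_sum, Derivation.leibniz, smul_eq_mul, ← Finset.sum_add_distrib]
  exact Finset.sum_congr rfl fun _ _ => by ring

/-- Stated for an arbitrary derivation because it serves D_x, the flow on functions of u, and the
partial derivatives. -/
theorem derivation_deltaInv (D : Derivation K (JetSeries m K) (JetSeries m K)) :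
    D (deltaInv K m)
      = -2 * dot (uVec K m 0) (fun i => D (uVec K m 0 i)) * deltaInv K m ^ 2 := by
  have h := D.leibniz_of_mul_eq_one (deltaInv_mul (K := K) (m := m))
  rw [h, map_add, Derivation.map_one_eq_zero, derivation_dot, dot_comm (fun i => D _), smul_eq_mul]
  ring

theorem sphereVec_castSucc (i : Fin m) :
    sphereVec K m i.castSucc = 2 * uVec K m 0 i * deltaInv K m :=
  Fin.snoc_castSucc (α := fun _ => JetSeries m K) _ _ _

theorem sphereVec_last : sphereVec K m (Fin.last m) = 2 * deltaInv K m - 1 := by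
  refine (Fin.snoc_last (α := fun _ => JetSeries m K) _ _).trans ?_
  linear_combination -deltaInv_mul (K := K) (m := m)

theorem dot_sphereVec_self : dot (sphereVec K m) (sphereVec K m) = 1 := by
  rw [dot, Fin.sum_univ_castSucc]
  simp only [sphereVec_castSucc, sphereVec_last]
  have h : ∑ i, 2 * uVec K m 0 i * deltaInv K m * (2 * uVec K m 0 i * deltaInv K m)
      = 4 * deltaInv K m ^ 2 * dot (uVec K m 0) (uVec K m 0) := by
    rw [dot, Finset.mul_sum]
    exact Finset.sum_congr rfl fun _ _ => by ring
  rw [h]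
  linear_combination 4 * deltaInv K m * deltaInv_mul (K := K) (m := m)

/-- By ⟨S,S⟩ = 1 the form is r_n + ∑ (r_i - r_n)(s^i)², which is the potential in the last term of
`rhs`. -/
theorem sphereQuad_eq (r : Fin (m + 1) → K) :
    sphereQuad r = MvPowerSeries.C (r (Fin.last m)) + 4 * deltaInv K m ^ 2
      * ∑ j : Fin m, (r j.castSucc - r (Fin.last m)) • uVec K m 0 j ^ 2 := by
  rw [sphereQuad, dot, Fin.sum_univ_castSucc]
  simp only [sphereVec_castSucc, sphereVec_last, MvPowerSeries.smul_eq_C_mul, map_sub]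
  have h : ∑ i, 2 * uVec K m 0 i * deltaInv K m
        * (MvPowerSeries.C (r i.castSucc) * (2 * uVec K m 0 i * deltaInv K m))
      = 4 * deltaInv K m ^ 2 * ∑ i, (MvPowerSeries.C (r i.castSucc)
          - MvPowerSeries.C (r (Fin.last m))) * uVec K m 0 i ^ 2
        + 4 * deltaInv K m ^ 2 * MvPowerSeries.C (r (Fin.last m))
          * dot (uVec K m 0) (uVec K m 0) := by
    rw [dot, Finset.mul_sum, Finset.mul_sum, ← Finset.sum_add_distrib]
    exact Finset.sum_congr rfl fun _ _ => by ring
  rw [h]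
  linear_combination 4 * deltaInv K m * MvPowerSeries.C (r (Fin.last m))
    * deltaInv_mul (K := K) (m := m)

theorem totalDx_uVec (k : ℕ) (i : Fin m) : totalDx K (uVec K m k i) = uVec K m (k + 1) i :=
  totalDx_X i k

theorem totalDx_dot_uVec (j k : ℕ) :
    totalDx K (dot (uVec K m j) (uVec K m k))
      = dot (uVec K m (j + 1)) (uVec K m k) + dot (uVec K m j) (uVec K m (k + 1)) := by
  rw [← totalDxDerivation_apply, derivation_dot]
  simp only [totalDxDerivation_apply, totalDx_uVec]

theorem totalDx_deltaInv : totalDx K (deltaInv K m)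
    = -2 * dot (uVec K m 0) (uVec K m 1) * deltaInv K m ^ 2 := by
  rw [← totalDxDerivation_apply, derivation_deltaInv]
  simp only [totalDxDerivation_apply, totalDx_uVec, zero_add]

theorem sphereVecX_castSucc (i : Fin m) : sphereVecX K m i.castSucc
    = 2 * uVec K m 1 i * deltaInv K m
      - 4 * dot (uVec K m 0) (uVec K m 1) * deltaInv K m ^ 2 * uVec K m 0 i := by
  rw [sphereVecX, sphereVec_castSucc, ← totalDxDerivation_apply]
  simp only [Derivation.leibniz, smul_eq_mul, derivation_two]
  simp only [totalDxDerivation_apply, totalDx_uVec, totalDx_deltaInv]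
  ring

theorem sphereVecX_last : sphereVecX K m (Fin.last m)
    = -4 * dot (uVec K m 0) (uVec K m 1) * deltaInv K m ^ 2 := by
  rw [sphereVecX, sphereVec_last, ← totalDxDerivation_apply]
  simp only [Derivation.leibniz, smul_eq_mul, derivation_two, map_sub, Derivation.map_one_eq_zero]
  simp only [totalDxDerivation_apply, totalDx_deltaInv]
  ring

/-- Stereographic projection is conformal, with factor 4Δ⁻² for the metric. -/
theorem dot_sphereVecX_self : dot (sphereVecX K m) (sphereVecX K m)
    = 4 * dot (uVec K m 1) (uVec K m 1) * deltaInv K m ^ 2 := by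
  rw [dot, Fin.sum_univ_castSucc]
  simp only [sphereVecX_castSucc, sphereVecX_last]
  set b := dot (uVec K m 0) (uVec K m 1) with hb
  have h : ∑ i, (2 * uVec K m 1 i * deltaInv K m - 4 * b * deltaInv K m ^ 2 * uVec K m 0 i)
        * (2 * uVec K m 1 i * deltaInv K m - 4 * b * deltaInv K m ^ 2 * uVec K m 0 i)
      = 4 * deltaInv K m ^ 2 * dot (uVec K m 1) (uVec K m 1)
        - 16 * b * deltaInv K m ^ 3 * b
        + 16 * b ^ 2 * deltaInv K m ^ 4 * dot (uVec K m 0) (uVec K m 0) := by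
    -- Only the last factor b of the cross term is opened into a sum; the other occurrences stay as
    -- scalars.
    conv_rhs => rw [hb, ← hb]; enter [1, 2, 2]; rw [hb]
    simp only [dot, Finset.mul_sum, ← Finset.sum_add_distrib, ← Finset.sum_sub_distrib]
    exact Finset.sum_congr rfl fun _ _ => by ring
  rw [h]
  linear_combination 16 * b ^ 2 * deltaInv K m ^ 3 * deltaInv_mul (K := K) (m := m)

/-- The derivation `∑ F^i ∂/∂u^i`, which agrees with `D_t` on functions of `u`. -/
def flowDerivation (F : Fin m → JetSeries m K) : Derivation K (JetSeries m K) (JetSeries m K) :=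
  ∑ i, F i • MvPowerSeries.pderiv K (i, 0)

theorem flowDerivation_apply (F : Fin m → JetSeries m K) (X : JetSeries m K) :
    flowDerivation F X = ∑ i, F i * MvPowerSeries.pderiv K (i, 0) X := by
  have h := map_sum (Derivation.coeFnAddMonoidHom (R := K) (A := JetSeries m K)
    (M := JetSeries m K)) (fun i => F i • MvPowerSeries.pderiv K (i, 0)) Finset.univ
  exact (congrFun h X).trans (Finset.sum_apply _ _ _)

theorem totalDt_eq_flowDerivation (F : Fin m → JetSeries m K) {X : JetSeries m K}
    (hX : DependsOnlyBelow 1 X) : totalDt F X = flowDerivation F X := by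
  ext γ
  rw [coef_totalDt F hX, flowDerivation_apply, coef_eq_coeff, map_sum, Finset.sum_product]
  refine Finset.sum_congr rfl fun i _ => ?_
  rw [Finset.range_one, Finset.sum_singleton, scale_eq_map_mul, partialD_eq_pderiv,
    coef_eq_coeff]
  simp

theorem flowDerivation_uVec (F : Fin m → JetSeries m K) (i : Fin m) :
    flowDerivation F (uVec K m 0 i) = F i := by
  classical
  rw [flowDerivation_apply, Finset.sum_eq_single i]
  · simp [uVec, jet]
  · intro j _ hj
    have : MvPowerSeries.pderiv K (j, 0) (uVec K m 0 i) = 0 :=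
      MvPowerSeries.pderiv_X_of_ne (by simpa using hj.symm)
    simp [this]
  · simp

/-- The coefficient of ∂X/∂s at γ divided by s is γ_s times that of X at γ, and γ_s is invertible in
characteristic zero. -/
theorem dependsOnlyBelow_of_pderiv_eq_zero [CharZero K] {d : ℕ} {X : JetSeries m K}
    (h : ∀ s : Fin m × ℕ, d ≤ s.2 → MvPowerSeries.pderiv K s X = 0) : DependsOnlyBelow d X := by
  intro γ hγ
  simp only [Exponents, Set.mem_ofPred_eq, not_forall, not_lt] at hγ
  obtain ⟨s, hs, hds⟩ := hγ
  rw [Finsupp.mem_support_iff] at hs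
  have h1 := MvPowerSeries.coeff_pderiv (i := s) X (γ - Finsupp.single s 1)
  rw [h s hds, tsub_add_cancel_of_le (by
    rw [Finsupp.single_le_iff]; omega), map_zero] at h1
  exact (mul_eq_zero.1 h1.symm).resolve_right (by norm_cast)

theorem dependsOnlyBelow_sphereVec [CharZero K] (i : Fin (m + 1)) :
    DependsOnlyBelow 1 (sphereVec K m i) := by
  refine dependsOnlyBelow_of_pderiv_eq_zero fun s hs => ?_
  have hu : ∀ j, MvPowerSeries.pderiv K s (uVec K m 0 j) = 0 := fun j =>
    MvPowerSeries.pderiv_X_of_ne (by rintro rfl; simp at hs)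
  have hd : MvPowerSeries.pderiv K s (deltaInv K m) = 0 := by
    simp [derivation_deltaInv, hu, dot]
  induction i using Fin.lastCases with
  | last => simp [sphereVec_last, hd, derivation_two]
  | cast i => simp [sphereVec_castSucc, hd, hu, derivation_two]

theorem dot_uVec_rhs (r : Fin (m + 1) → K) :
    dot (uVec K m 0) (rhs r)
      = dot (uVec K m 0) (uVec K m 3)
        - 6 * dot (uVec K m 0) (uVec K m 1) * deltaInv K m * dot (uVec K m 0) (uVec K m 2)
        + (-6 * dot (uVec K m 0) (uVec K m 2) * deltaInv K m
            + 24 * dot (uVec K m 0) (uVec K m 1) ^ 2 * deltaInv K m ^ 2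
            - 6 * dot (uVec K m 0) (uVec K m 0) * dot (uVec K m 1) (uVec K m 1)
              * deltaInv K m ^ 2) * dot (uVec K m 0) (uVec K m 1)
        + (6 * dot (uVec K m 1) (uVec K m 2) * deltaInv K m
            - 12 * dot (uVec K m 0) (uVec K m 1) * dot (uVec K m 1) (uVec K m 1)
              * deltaInv K m ^ 2) * dot (uVec K m 0) (uVec K m 0)
        + MvPowerSeries.C (3 / 2) * (sphereQuad r * dot (uVec K m 0) (uVec K m 1)) := by
  -- The right-hand side is a combination of u_xxx, u_xx, u_x, u with scalar series as coefficients,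
  -- and pairing with u is linear over these.
  have key : ∀ (p q s t : JetSeries m K) (F : Fin m → JetSeries m K),
      (∀ i, F i = uVec K m 3 i + p * uVec K m 2 i + q * uVec K m 1 i + s * uVec K m 0 i
        + t * uVec K m 1 i) →
      dot (uVec K m 0) F = dot (uVec K m 0) (uVec K m 3) + p * dot (uVec K m 0) (uVec K m 2)
        + q * dot (uVec K m 0) (uVec K m 1) + s * dot (uVec K m 0) (uVec K m 0)
        + t * dot (uVec K m 0) (uVec K m 1) := by
    intro p q s t F hF
    simp only [dot, hF, Finset.mul_sum, ← Finset.sum_add_distrib]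
    exact Finset.sum_congr rfl fun _ _ => by ring
  rw [key _ _ _ (MvPowerSeries.C (3 / 2) * sphereQuad r) (rhs r) fun i => by
    rw [rhs, ← sphereQuad_eq, MvPowerSeries.smul_eq_C_mul, ← mul_assoc, sub_eq_add_neg (uVec K m 3 i),
      ← neg_mul]]
  ring

theorem totalDt_rhs_sphereVec [CharZero K] (r : Fin (m + 1) → K) (i : Fin (m + 1)) :
    totalDt (rhs r) (sphereVec K m i) = sphereRHS r i := by
  have hC : 2 * (MvPowerSeries.C (3 / 2) : JetSeries m K) = 3 := by
    rw [← map_ofNat MvPowerSeries.C 2, ← map_mul, mul_div_cancel₀ _ two_ne_zero, map_ofNat]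
  have hDC : totalDxDerivation K K m (MvPowerSeries.C (3 / 2)) = 0 :=
    (totalDxDerivation K K m).map_algebraMap (3 / 2)
  have Db := totalDx_dot_uVec (K := K) (m := m) 0 1
  have Dc := totalDx_dot_uVec (K := K) (m := m) 1 1
  rw [dot_comm (uVec K m (1 + 1)), ← two_mul] at Dc
  have De := totalDx_dot_uVec (K := K) (m := m) 0 2
  rw [totalDt_eq_flowDerivation _ (dependsOnlyBelow_sphereVec i), sphereRHS, sphereVecX]
  simp only [MvPowerSeries.smul_eq_C_mul, dot_sphereVecX_self]
  induction i using Fin.lastCases with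
  | last =>
    simp only [sphereVec_last]
    have := derivation_stereographic_last (totalDxDerivation K K m) deltaInv_mul hC hDC
      Db Dc De totalDx_deltaInv (dot_uVec_rhs r)
    refine Eq.trans ?_ this
    simp only [map_sub, Derivation.leibniz, smul_eq_mul, derivation_two, mul_zero, add_zero,
      Derivation.map_one_eq_zero, sub_zero, derivation_deltaInv, flowDerivation_uVec, mul_assoc]
  | cast i =>
    simp only [sphereVec_castSucc]
    have := derivation_stereographic (totalDxDerivation K K m) deltaInv_mul hC hDC
      (totalDx_uVec 0 i) (totalDx_uVec 1 i) (totalDx_uVec 2 i)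
      Db Dc De totalDx_deltaInv (F := rhs r i) (ρ := sphereQuad r)
      (by rw [rhs, ← sphereQuad_eq, MvPowerSeries.smul_eq_C_mul]) (dot_uVec_rhs r)
    refine Eq.trans ?_ this
    simp only [Derivation.leibniz, smul_eq_mul, derivation_two, mul_zero, add_zero,
      derivation_deltaInv, flowDerivation_uVec]
    ring

end Sphere
end LandauLifshitz

namespace LandauLifshitz

/-! ### Matrix-valued series entry by entry -/

section Entries

variable {K A : Type*} [Field K] [CommRing A] [Algebra K A] {m n : ℕ}

/-- The series of the entries of a matrix-valued series at a given position. -/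
def entrySeries (K : Type*) [Field K] [Algebra K A] (p q : Fin n ⊕ Unit)
    (X : JetSeries m (Mat n A)) : JetSeries m A :=
  mapCoef (Matrix.entryLinearMap K A p q) X

theorem coef_entrySeries (p q : Fin n ⊕ Unit) (X : JetSeries m (Mat n A))
    (γ : (Fin m × ℕ) →₀ ℕ) : coef γ (entrySeries K p q X) = coef γ X p q := rfl

theorem entrySeries_injective {X Y : JetSeries m (Mat n A)}
    (h : ∀ p q, entrySeries K p q X = entrySeries K p q Y) : X = Y := by
  ext γ p q
  have := congrArg (coef γ) (h p q)
  simpa only [coef_entrySeries] using this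

variable (p q : Fin n ⊕ Unit) (X Y : JetSeries m (Mat n A))

theorem entrySeries_add :
    entrySeries K p q (X + Y) = entrySeries K p q X + entrySeries K p q Y := mapCoef_add _ _ _

theorem entrySeries_sub :
    entrySeries K p q (X - Y) = entrySeries K p q X - entrySeries K p q Y := mapCoef_sub _ _ _

theorem entrySeries_zero : entrySeries K p q (0 : JetSeries m (Mat n A)) = 0 := rfl

theorem entrySeries_totalDx :
    entrySeries K p q (totalDx K X) = totalDx K (entrySeries K p q X) :=
  (totalDx_mapCoef _ _).symm

theorem entrySeries_totalDt {d : ℕ} (F : Fin m → JetSeries m K) {X : JetSeries m (Mat n A)}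
    (hX : DependsOnlyBelow d X) :
    entrySeries K p q (totalDt F X) = totalDt F (entrySeries K p q X) :=
  (totalDt_mapCoef F _ hX).symm

theorem entrySeries_scale (f : JetSeries m K) : entrySeries K p q (scale f X)
    = MvPowerSeries.map (algebraMap K A) f * entrySeries K p q X := by
  rw [← scale_eq_map_mul]
  exact (scale_mapCoef _ _ _).symm

theorem entrySeries_smul (c : A) :
    entrySeries K p q (c • X) = MvPowerSeries.C c * entrySeries K p q X := by
  rw [← MvPowerSeries.smul_eq_C_mul]
  rfl

theorem entrySeries_bracket : entrySeries K p q (bracket X Y)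
    = ∑ k, (entrySeries K p k X * entrySeries K k q Y
        - entrySeries K k q X * entrySeries K p k Y) := by
  ext γ
  rw [coef_entrySeries, coef_eq_coeff _ (∑ k, _), map_sum]
  simp only [map_sub, MvPowerSeries.coeff_mul, ← Finset.sum_sub_distrib]
  rw [Finset.sum_comm]
  change (∑ s ∈ Finset.HasAntidiagonal.antidiagonal γ, ⁅coef s.1 X, coef s.2 Y⁆) p q = _
  rw [Matrix.sum_apply]
  refine Finset.sum_congr rfl fun s _ => ?_
  rw [LieRing.of_associative_ring_bracket, Matrix.sub_apply, Matrix.mul_apply, Matrix.mul_apply,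
    ← Finset.sum_sub_distrib]
  refine Finset.sum_congr rfl fun k _ => ?_
  simp only [← coef_eq_coeff, coef_entrySeries]
  rw [mul_comm (coef s.2 Y p k)]

theorem map_totalDx (f : JetSeries m K) :
    MvPowerSeries.map (algebraMap K A) (totalDx K f)
      = totalDx K (MvPowerSeries.map (algebraMap K A) f) :=
  (totalDx_mapCoef (Algebra.linearMap K A) f).symm

end Entries

section Boost

variable {A : Type*} [CommRing A] {n : ℕ} (i j k : Fin n) (q : A)

theorem boost_apply_inl_inr :
    (boost i q : Mat n A) (Sum.inl j) (Sum.inr ()) = if i = j then q else 0 := by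
  simp [boost, Matrix.single_apply]

theorem boost_apply_inr_inl :
    (boost i q : Mat n A) (Sum.inr ()) (Sum.inl j) = if i = j then q else 0 := by
  simp [boost, Matrix.single_apply]

theorem boost_apply_inl_inl : (boost i q : Mat n A) (Sum.inl j) (Sum.inl k) = 0 := by
  simp [boost]

theorem boost_apply_inr_inr : (boost i q : Mat n A) (Sum.inr ()) (Sum.inr ()) = 0 := by
  simp [boost]

end Boost

/-! ### The zero-curvature representation -/

section ZeroCurvature

variable {K A : Type*} [Field K] [CommRing A] [Algebra K A] {m : ℕ}
  (l : Fin (m + 1) → A) (r : Fin (m + 1) → K)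

/-- The series `λ_i s^i`. -/
def boostEntry (K : Type*) [Field K] [Algebra K A] (l : Fin (m + 1) → A) (i : Fin (m + 1)) :
    JetSeries m A :=
  MvPowerSeries.C (l i) * MvPowerSeries.map (algebraMap K A) (sphereVec K m i)

theorem coef_zcrM (γ : (Fin m × ℕ) →₀ ℕ) :
    coef γ (zcrM K l) = ∑ i, coef γ (sphereVec K m i) • boost i (l i) := rfl

theorem coef_boostEntry (i : Fin (m + 1)) (γ : (Fin m × ℕ) →₀ ℕ) :
    coef γ (boostEntry K l i) = coef γ (sphereVec K m i) • l i := by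
  rw [boostEntry, coef_eq_coeff, MvPowerSeries.coeff_C_mul, MvPowerSeries.coeff_map,
    Algebra.smul_def, mul_comm]
  rfl

theorem entrySeries_zcrM_inl_inr (i : Fin (m + 1)) :
    entrySeries K (Sum.inl i) (Sum.inr ()) (zcrM K l) = boostEntry K l i := by
  ext γ
  rw [coef_entrySeries, coef_zcrM, Matrix.sum_apply, coef_boostEntry]
  simp [boost_apply_inl_inr]

theorem entrySeries_zcrM_inr_inl (i : Fin (m + 1)) :
    entrySeries K (Sum.inr ()) (Sum.inl i) (zcrM K l) = boostEntry K l i := by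
  ext γ
  rw [coef_entrySeries, coef_zcrM, Matrix.sum_apply, coef_boostEntry]
  simp [boost_apply_inr_inl]

theorem entrySeries_zcrM_inl_inl (i j : Fin (m + 1)) :
    entrySeries K (Sum.inl i) (Sum.inl j) (zcrM K l) = 0 := by
  ext γ
  rw [coef_entrySeries, coef_zcrM, Matrix.sum_apply]
  simp [boost_apply_inl_inl, coef_zero]

theorem entrySeries_zcrM_inr_inr :
    entrySeries K (Sum.inr ()) (Sum.inr ()) (zcrM K l) = 0 := by
  ext γ
  rw [coef_entrySeries, coef_zcrM, Matrix.sum_apply]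
  simp [boost_apply_inr_inr, coef_zero]

theorem dependsOnlyBelow_zcrM [CharZero K] : DependsOnlyBelow 1 (zcrM K l) := fun γ hγ => by
  rw [coef_zcrM]
  exact Finset.sum_eq_zero fun i _ => by rw [dependsOnlyBelow_sphereVec i γ hγ, zero_smul]

/-- Naturality under the K-linear map c ↦ λ_i c from K to A reduces this to the equation for s^i. -/
theorem totalDt_boostEntry [CharZero K] (i : Fin (m + 1)) :
    totalDt (rhs r) (boostEntry K l i)
      = MvPowerSeries.C (l i) * MvPowerSeries.map (algebraMap K A) (sphereRHS r i) := by
  have h : ∀ f : JetSeries m K,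
      mapCoef (LinearMap.mulLeft K (l i) ∘ₗ Algebra.linearMap K A) f
        = MvPowerSeries.C (l i) * MvPowerSeries.map (algebraMap K A) f := fun f => by
    ext γ
    rw [coef_eq_coeff _ (_ * _), MvPowerSeries.coeff_C_mul, MvPowerSeries.coeff_map]
    rfl
  rw [boostEntry, ← h, totalDt_mapCoef _ _ (dependsOnlyBelow_sphereVec i), h,
    totalDt_rhs_sphereVec]

theorem totalDx_C_mul (c : A) (X : JetSeries m A) :
    totalDx K (MvPowerSeries.C c * X) = MvPowerSeries.C c * totalDx K X := by
  rw [← MvPowerSeries.smul_eq_C_mul, ← MvPowerSeries.smul_eq_C_mul]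
  exact (totalDxDerivation K A m).map_smul c X

theorem totalDx_zero : totalDx K (0 : JetSeries m A) = 0 := (totalDxDerivation K A m).map_zero

theorem totalDx_add (X Y : JetSeries m A) :
    totalDx K (X + Y) = totalDx K X + totalDx K Y := (totalDxDerivation K A m).map_add X Y

theorem totalDx_sub (X Y : JetSeries m A) :
    totalDx K (X - Y) = totalDx K X - totalDx K Y := (totalDxDerivation K A m).map_sub X Y

theorem totalDx_mul (X Y : JetSeries m A) :
    totalDx K (X * Y) = X * totalDx K Y + Y * totalDx K X :=
  (totalDxDerivation K A m).leibniz X Y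

theorem entrySeries_zcrN (p q : Fin (m + 1) ⊕ Unit) :
    entrySeries K p q (zcrN r l) = totalDx K (totalDx K (entrySeries K p q (zcrM K l)))
      + ∑ k, (totalDx K (entrySeries K p k (zcrM K l)) * entrySeries K k q (zcrM K l)
        - totalDx K (entrySeries K k q (zcrM K l)) * entrySeries K p k (zcrM K l))
      + MvPowerSeries.C (algebraMap K A (r 0) + l 0 ^ 2) * entrySeries K p q (zcrM K l)
      + MvPowerSeries.map (algebraMap K A) ((1 / 2 : K) • sphereQuad r
        + (3 / 2 : K) • dot (sphereVecX K m) (sphereVecX K m)) * entrySeries K p q (zcrM K l) := by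
  rw [zcrN, entrySeries_add, entrySeries_add, entrySeries_add, entrySeries_bracket,
    entrySeries_smul, entrySeries_scale]
  simp only [entrySeries_totalDx]

/-- The coefficient of `M` in the last two summands of `N`. -/
def zcrPotential (l : Fin (m + 1) → A) (r : Fin (m + 1) → K) : JetSeries m A :=
  MvPowerSeries.C (algebraMap K A (r 0) + l 0 ^ 2)
    + MvPowerSeries.map (algebraMap K A) ((1 / 2 : K) • sphereQuad r
      + (3 / 2 : K) • dot (sphereVecX K m) (sphereVecX K m))

theorem entrySeries_zcrN_inl_inr (i : Fin (m + 1)) :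
    entrySeries K (Sum.inl i) (Sum.inr ()) (zcrN r l)
      = totalDx K (totalDx K (boostEntry K l i)) + zcrPotential l r * boostEntry K l i := by
  rw [entrySeries_zcrN, Fintype.sum_sum_type]
  simp only [entrySeries_zcrM_inl_inr, entrySeries_zcrM_inl_inl, entrySeries_zcrM_inr_inr,
    totalDx_zero, zero_mul, mul_zero, sub_zero, Finset.sum_const_zero, add_zero, zcrPotential,
    Finset.univ_unique, Finset.sum_singleton, PUnit.default_eq_unit]
  ring

theorem entrySeries_zcrN_inr_inl (i : Fin (m + 1)) :
    entrySeries K (Sum.inr ()) (Sum.inl i) (zcrN r l)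
      = totalDx K (totalDx K (boostEntry K l i)) + zcrPotential l r * boostEntry K l i := by
  rw [entrySeries_zcrN, Fintype.sum_sum_type]
  simp only [entrySeries_zcrM_inr_inl, entrySeries_zcrM_inl_inl, entrySeries_zcrM_inr_inr,
    totalDx_zero, zero_mul, mul_zero, sub_zero, Finset.sum_const_zero, add_zero, zcrPotential,
    Finset.univ_unique, Finset.sum_singleton, PUnit.default_eq_unit]
  ring

theorem entrySeries_zcrN_inl_inl (i j : Fin (m + 1)) :
    entrySeries K (Sum.inl i) (Sum.inl j) (zcrN r l)
      = totalDx K (boostEntry K l i) * boostEntry K l j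
        - totalDx K (boostEntry K l j) * boostEntry K l i := by
  rw [entrySeries_zcrN, Fintype.sum_sum_type]
  simp only [entrySeries_zcrM_inl_inr, entrySeries_zcrM_inr_inl, entrySeries_zcrM_inl_inl,
    totalDx_zero, mul_zero, sub_zero, Finset.sum_const_zero, add_zero, zero_add,
    Finset.univ_unique, Finset.sum_singleton, PUnit.default_eq_unit]

theorem entrySeries_zcrN_inr_inr :
    entrySeries K (Sum.inr ()) (Sum.inr ()) (zcrN r l) = 0 := by
  rw [entrySeries_zcrN, Fintype.sum_sum_type]
  simp only [entrySeries_zcrM_inl_inr, entrySeries_zcrM_inr_inl, entrySeries_zcrM_inr_inr,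
    totalDx_zero, mul_zero, sub_self, Finset.sum_const_zero, add_zero]

/-- The only place where the curve enters the zero-curvature equation: λ_k² = λ - r_k, summed
against (s^k)² with ⟨S,S⟩ = 1. -/
theorem sum_boostEntry_sq {l : Fin (m + 1) → A} (hl : OnCurve r l) :
    ∑ k, boostEntry K l k * boostEntry K l k
      = MvPowerSeries.C (algebraMap K A (r 0) + l 0 ^ 2)
        - MvPowerSeries.map (algebraMap K A) (sphereQuad r) := by
  have h : ∀ k, boostEntry K l k * boostEntry K l k
      = MvPowerSeries.C (algebraMap K A (r 0) + l 0 ^ 2)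
          * MvPowerSeries.map (algebraMap K A) (sphereVec K m k * sphereVec K m k)
        - MvPowerSeries.map (algebraMap K A) (sphereVec K m k * r k • sphereVec K m k) := by
    intro k
    have h1 : l k ^ 2 = algebraMap K A (r 0) + l 0 ^ 2 - algebraMap K A (r k) := by
      have := hl k 0
      rw [map_sub] at this
      linear_combination this
    have h2 := congrArg (MvPowerSeries.C (σ := Fin m × ℕ)) h1
    rw [map_sub, map_pow] at h2
    rw [boostEntry, MvPowerSeries.smul_eq_C_mul]
    simp only [map_mul, MvPowerSeries.map_C]
    linear_combination MvPowerSeries.map (algebraMap K A) (sphereVec K m k) ^ 2 * h2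
  have h3 : ∑ k, sphereVec K m k * sphereVec K m k = 1 := dot_sphereVec_self
  simp only [h, Finset.sum_sub_distrib, ← Finset.mul_sum, ← map_sum, h3, map_one, mul_one]
  rfl

/-- The boost entry of the curvature. After ∑ v_k² = λ - q is inserted, the terms with λ and p
cancel, the terms in q v' have total coefficient 1/2 - 3/2 + 1 = 0, and q'v/2 cancels against v ∑
v_k v_k'. -/
theorem zcr_vector_identity [CharZero K] {l : Fin (m + 1) → A} (hl : OnCurve r l)
    (i : Fin (m + 1)) :
    totalDx K (totalDx K (totalDx K (boostEntry K l i)) + zcrPotential l r * boostEntry K l i)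
      - totalDt (rhs r) (boostEntry K l i)
      - ∑ k, boostEntry K l k * (totalDx K (boostEntry K l i) * boostEntry K l k
        - totalDx K (boostEntry K l k) * boostEntry K l i) = 0 := by
  have hQ := sum_boostEntry_sq r hl
  have hW := congrArg (totalDx K) hQ
  have hC : ∀ c : A, totalDx K (MvPowerSeries.C c : JetSeries m A) = 0 := fun c =>
    (totalDxDerivation K A m).map_algebraMap c
  have hsum : totalDx K (∑ k, boostEntry K l k * boostEntry K l k)
      = 2 * ∑ k, boostEntry K l k * totalDx K (boostEntry K l k) := by
    rw [← totalDxDerivation_apply, map_sum, Finset.mul_sum]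
    refine Finset.sum_congr rfl fun k _ => ?_
    rw [totalDxDerivation_apply, totalDx_mul]
    ring
  rw [hsum, totalDx_sub, hC] at hW
  have hS : ∑ k, boostEntry K l k * (totalDx K (boostEntry K l i) * boostEntry K l k
        - totalDx K (boostEntry K l k) * boostEntry K l i)
      = totalDx K (boostEntry K l i) * ∑ k, boostEntry K l k * boostEntry K l k
        - boostEntry K l i * ∑ k, boostEntry K l k * totalDx K (boostEntry K l k) := by
    rw [Finset.mul_sum, Finset.mul_sum, ← Finset.sum_sub_distrib]
    exact Finset.sum_congr rfl fun k _ => by ring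
  rw [hS, hQ, totalDt_boostEntry]
  set W := ∑ k, boostEntry K l k * totalDx K (boostEntry K l k)
  have h2 : (MvPowerSeries.C (algebraMap K A (1 / 2)) : JetSeries m A) * 2 = 1 := by
    rw [← map_ofNat (MvPowerSeries.C.comp (algebraMap K A)) 2, RingHom.comp_apply, ← map_mul,
      ← map_mul, div_mul_cancel₀ _ two_ne_zero, map_one, map_one]
  have h3 : (MvPowerSeries.C (algebraMap K A (3 / 2)) : JetSeries m A)
      = 3 * MvPowerSeries.C (algebraMap K A (1 / 2)) := by
    rw [← map_ofNat (MvPowerSeries.C.comp (algebraMap K A)) 3, RingHom.comp_apply, ← map_mul,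
      ← map_mul, mul_one_div]
  have hR : MvPowerSeries.C (l i) * MvPowerSeries.map (algebraMap K A) (sphereRHS r i)
      = totalDx K (totalDx K (totalDx K (boostEntry K l i))
          + MvPowerSeries.C (algebraMap K A (3 / 2))
            * (MvPowerSeries.map (algebraMap K A) (dot (sphereVecX K m) (sphereVecX K m))
              * boostEntry K l i))
        + MvPowerSeries.C (algebraMap K A (3 / 2))
          * (MvPowerSeries.map (algebraMap K A) (sphereQuad r)
            * totalDx K (boostEntry K l i)) := by
    rw [sphereRHS, sphereVecX]
    simp only [MvPowerSeries.smul_eq_C_mul, map_add, map_mul, map_totalDx, MvPowerSeries.map_C,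
      boostEntry, totalDx_C_mul, totalDx_add]
    rw [mul_left_comm (MvPowerSeries.map (algebraMap K A) (dot (sphereVecX K m) (sphereVecX K m))),
      totalDx_C_mul]
    ring
  rw [hR, zcrPotential]
  simp only [MvPowerSeries.smul_eq_C_mul, map_add, map_mul, MvPowerSeries.map_C, totalDx_add,
    totalDx_mul, hC, h3]
  have h4 : totalDx K (3 : JetSeries m A) = 0 := by
    have := hC 3
    rwa [map_ofNat] at this
  rw [h4]
  generalize MvPowerSeries.map (algebraMap K A) (sphereQuad r) = q at *
  generalize MvPowerSeries.map (algebraMap K A) (dot (sphereVecX K m) (sphereVecX K m)) = p at *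
  generalize (MvPowerSeries.C (algebraMap K A (1 / 2)) : JetSeries m A) = c at *
  generalize boostEntry K l i = v at *
  generalize totalDx K v = v1 at *
  generalize totalDx K q = q1 at *
  -- Here c stands for 1/2: `hW` says 2W = -q', and `h2` (c · 2 = 1) clears the remaining halves.
  linear_combination c * v * hW - v * W * h2 - q * v1 * h2

theorem curvature_zcr [CharZero K] {l : Fin (m + 1) → A} (hl : OnCurve r l) :
    curvature (rhs r) (zcrM K l) (zcrN r l) = 0 := by
  refine entrySeries_injective (K := K) fun p q => ?_
  rw [curvature, entrySeries_add, entrySeries_sub, entrySeries_totalDx,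
    entrySeries_totalDt _ _ _ (dependsOnlyBelow_zcrM l), entrySeries_bracket,
    Fintype.sum_sum_type, entrySeries_zero]
  -- D_t(0) = 0 is naturality of D_t under the zero map.
  have hDt : totalDt (rhs r) (0 : JetSeries m A) = 0 := by
    have h := totalDt_mapCoef (rhs r) (0 : K →ₗ[K] A) (dependsOnlyBelow_sphereVec (K := K) (m := m) 0)
    exact h
  have key := zcr_vector_identity r hl
  match p, q with
  | Sum.inl i, Sum.inl j =>
    simp only [entrySeries_zcrM_inl_inr, entrySeries_zcrM_inr_inl, entrySeries_zcrM_inl_inl,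
      entrySeries_zcrN_inl_inr, entrySeries_zcrN_inr_inl, entrySeries_zcrN_inl_inl, hDt,
      totalDx_sub, totalDx_mul, zero_mul, sub_zero, zero_add,
      Finset.sum_const_zero, Finset.univ_unique, Finset.sum_singleton, PUnit.default_eq_unit]
    ring
  | Sum.inl i, Sum.inr () =>
    simp only [entrySeries_zcrM_inl_inr, entrySeries_zcrM_inl_inl, entrySeries_zcrM_inr_inr,
      entrySeries_zcrN_inl_inr, entrySeries_zcrN_inl_inl, entrySeries_zcrN_inr_inr, zero_mul,
      mul_zero, zero_sub, add_zero, Finset.univ_unique, Finset.sum_singleton,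
      PUnit.default_eq_unit, sub_self]
    rw [Finset.sum_neg_distrib, ← sub_eq_add_neg]
    exact key i
  | Sum.inr (), Sum.inl j =>
    simp only [entrySeries_zcrM_inr_inl, entrySeries_zcrM_inl_inl, entrySeries_zcrM_inr_inr,
      entrySeries_zcrN_inr_inl, entrySeries_zcrN_inl_inl, entrySeries_zcrN_inr_inr, zero_mul,
      mul_zero, sub_zero, add_zero, Finset.univ_unique, Finset.sum_singleton,
      PUnit.default_eq_unit, sub_self]
    rw [← key j, sub_eq_add_neg _ (∑ k, _), ← Finset.sum_neg_distrib]
    congr 1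
    exact Finset.sum_congr rfl fun k _ => by ring
  | Sum.inr (), Sum.inr () =>
    simp only [entrySeries_zcrM_inl_inr, entrySeries_zcrM_inr_inl, entrySeries_zcrM_inr_inr,
      entrySeries_zcrN_inl_inr, entrySeries_zcrN_inr_inl, entrySeries_zcrN_inr_inr, hDt,
      totalDx_zero, zero_mul, sub_zero, add_zero, zero_add,
      Finset.univ_unique, Finset.sum_singleton, PUnit.default_eq_unit]
    exact Finset.sum_eq_zero fun k _ => by ring

end ZeroCurvature
end LandauLifshitz

namespace LandauLifshitz

/-! ### Brackets of boosts and rotations -/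

section Brackets

variable {A : Type*} [CommRing A] {n : ℕ}

theorem single_mul_single_ite {ι : Type*} [Fintype ι] [DecidableEq ι] (a b c d : ι) (p q : A) :
    Matrix.single a b p * Matrix.single c d q
      = if b = c then Matrix.single a d (p * q) else 0 := by
  split_ifs with h
  · subst h
    exact Matrix.single_mul_single_same ..
  · exact Matrix.single_mul_single_of_ne (h := h) ..

theorem lie_boost_boost (i j : Fin n) (p q : A) :
    ⁅(boost i p : Mat n A), boost j q⁆ = rotation i j (p * q) := by
  simp only [LieRing.of_associative_ring_bracket, boost, rotation, add_mul, mul_add,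
    single_mul_single_ite, Sum.inl.injEq, reduceCtorEq, if_true, if_false, mul_comm q p, eq_comm]
  abel

theorem lie_rotation_boost (i j k : Fin n) (p q : A) :
    ⁅(rotation i j p : Mat n A), boost k q⁆
      = (if j = k then boost i (p * q) else 0) - if i = k then boost j (p * q) else 0 := by
  simp only [LieRing.of_associative_ring_bracket, boost, rotation, add_mul, mul_add, sub_mul,
    mul_sub, single_mul_single_ite, Sum.inl.injEq, reduceCtorEq, if_false, mul_comm q p,
    eq_comm (a := k)]
  split_ifs <;> abel

theorem lie_rotation_rotation (i j k l : Fin n) (p q : A) :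
    ⁅(rotation i j p : Mat n A), rotation k l q⁆
      = (if j = k then rotation i l (p * q) else 0) - (if j = l then rotation i k (p * q) else 0)
        - (if i = k then rotation j l (p * q) else 0)
        + if i = l then rotation j k (p * q) else 0 := by
  simp only [LieRing.of_associative_ring_bracket, rotation, sub_mul,
    mul_sub, single_mul_single_ite, Sum.inl.injEq, mul_comm q p,
    eq_comm (a := k), eq_comm (a := l)]
  split_ifs <;> abel

theorem boost_add (i : Fin n) (p q : A) :
    (boost i (p + q) : Mat n A) = boost i p + boost i q := by
  simp only [boost, Matrix.single_add]; abel

theorem rotation_add (i j : Fin n) (p q : A) :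
    (rotation i j (p + q) : Mat n A) = rotation i j p + rotation i j q := by
  simp only [rotation, Matrix.single_add]; abel

theorem boost_smul {K : Type*} [Field K] [Algebra K A] (i : Fin n) (c : K) (p : A) :
    (boost i (c • p) : Mat n A) = c • boost i p := by
  simp only [boost, ← Matrix.smul_single, smul_add]

theorem rotation_smul {K : Type*} [Field K] [Algebra K A] (i j : Fin n) (c : K)
    (p : A) : (rotation i j (c • p) : Mat n A) = c • rotation i j p := by
  simp only [rotation, ← Matrix.smul_single, smul_sub]

theorem rotation_self (i : Fin n) (p : A) : (rotation i i p : Mat n A) = 0 := sub_self _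

theorem rotation_swap (i j : Fin n) (p : A) :
    (rotation i j p : Mat n A) = -rotation j i p := (neg_sub _ _).symm

theorem rotation_apply_of_lt {i j k l : Fin n} (hij : i < j) (hkl : k < l) (p : A) :
    (rotation i j p : Mat n A) (Sum.inl k) (Sum.inl l) = if i = k ∧ j = l then p else 0 := by
  simp only [rotation, Matrix.sub_apply, Matrix.single_apply, Sum.inl.injEq]
  have : ¬(j = k ∧ i = l) := by rintro ⟨rfl, rfl⟩; exact lt_asymm hij hkl
  rw [if_neg this, sub_zero]

theorem rotation_apply_inl_inr (i j k : Fin n) (p : A) :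
    (rotation i j p : Mat n A) (Sum.inl k) (Sum.inr ()) = 0 := by
  simp [rotation]

theorem boost_mem_so' (i : Fin n) (q : A) :
    boost i q ∈ LieAlgebra.Orthogonal.so' (Fin n) Unit A := by
  rw [LieAlgebra.Orthogonal.so', mem_skewAdjointMatricesLieSubalgebra,
    mem_skewAdjointMatricesSubmodule, Matrix.IsSkewAdjoint, Matrix.IsAdjointPair,
    LieAlgebra.Orthogonal.indefiniteDiagonal]
  ext a b
  rw [Matrix.mul_diagonal, Matrix.diagonal_mul]
  rcases a with a | a <;> rcases b with b | b <;> simp [boost, Matrix.single_apply]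
  split_ifs <;> simp

/-- The Lie algebra `so_{n,1} ⊗ A`, with scalars restricted to `K`. -/
def orthogonalSubalgebra (K A : Type*) [Field K] [CommRing A] [Algebra K A] (n : ℕ) :
    LieSubalgebra K (Mat n A) where
  toSubmodule := (LieAlgebra.Orthogonal.so' (Fin n) Unit A).toSubmodule.restrictScalars K
  lie_mem' := (LieAlgebra.Orthogonal.so' (Fin n) Unit A).lie_mem'

end Brackets

/-! ### Functions on the curve -/

section CurveRing

open Polynomial

variable {K : Type*} [Field K] {n : ℕ}

theorem coord_sq_sub (r : Fin n → K) (i j : Fin n) :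
    coord r i ^ 2 - coord r j ^ 2 = algebraMap K (CurveRing r) (r j - r i) := by
  have h : Ideal.Quotient.mk (curveIdeal r) (MvPolynomial.X i ^ 2 - MvPolynomial.X j ^ 2
      + MvPolynomial.C (r i) - MvPolynomial.C (r j)) = 0 :=
    Ideal.Quotient.eq_zero_iff_mem.2 (Ideal.subset_span ⟨(i, j), rfl⟩)
  have hC : ∀ c, Ideal.Quotient.mk (curveIdeal r) (MvPolynomial.C c)
    = algebraMap K (CurveRing r) c := fun _ => rfl
  simp only [map_sub, map_add, map_pow, hC] at h
  rw [map_sub, coord, coord]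
  linear_combination h

theorem boost_coord_mem_algL (r : Fin n → K) (i : Fin n) : boost i (coord r i) ∈ algL r :=
  LieSubalgebra.subset_lieSpan ⟨i, rfl⟩

theorem onCurve_coord (r : Fin n → K) : OnCurve r (coord r) := coord_sq_sub r

theorem coord_sq [NeZero n] (r : Fin n → K) (i : Fin n) :
    coord r i ^ 2 = spectral r - algebraMap K (CurveRing r) (r i) := by
  have := coord_sq_sub r i 0
  rw [map_sub] at this
  rw [spectral]
  linear_combination this

/-- Evaluation of functions on the curve at a point over an extension field. -/
theorem exists_curve_point [NeZero n] (r : Fin n → K) (c : K) :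
    ∃ f : CurveRing r →ₐ[K] AlgebraicClosure K,
      f (spectral r) = algebraMap K (AlgebraicClosure K) c ∧
      ∀ i, f (coord r i) ^ 2 = algebraMap K (AlgebraicClosure K) (c - r i) := by
  -- Any choice of square roots s_i of c - r_i is a point of the curve with λ = c; the algebraic
  -- closure is needed since c - r_i may not be a square in K.
  choose s hs using fun i => IsAlgClosed.exists_pow_nat_eq
    (algebraMap K (AlgebraicClosure K) (c - r i)) two_pos
  have hker : ∀ a ∈ curveIdeal r, (MvPolynomial.aeval s : _ →ₐ[K] AlgebraicClosure K) a = 0 := by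
    intro a ha
    have : curveIdeal r ≤ RingHom.ker (MvPolynomial.aeval s : _ →ₐ[K] AlgebraicClosure K) := by
      refine Ideal.span_le.2 ?_
      rintro _ ⟨p, rfl⟩
      simp only [SetLike.mem_coe, RingHom.mem_ker, map_sub, map_add, map_pow,
        MvPolynomial.aeval_X, MvPolynomial.aeval_C, hs]
      ring
    exact this ha
  have hf : ∀ i, Ideal.Quotient.liftₐ (curveIdeal r) (MvPolynomial.aeval s) hker (coord r i)
      = s i := fun i => by
    exact (Ideal.Quotient.lift_mk _ _ _).trans (MvPolynomial.aeval_X s i)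
  refine ⟨Ideal.Quotient.liftₐ (curveIdeal r) (MvPolynomial.aeval s) hker, ?_, fun i => ?_⟩
  · rw [spectral, map_add, map_pow, hf, hs, AlgHom.commutes, ← map_add, sub_add_cancel]
  · rw [hf, hs]

/-- At a curve point with λ = c and c ≠ r_i, r_j the factors λ_i, λ_j do not vanish, so p(c) = 0.
This holds for infinitely many c. -/
theorem eq_zero_of_aeval_spectral_mul [Infinite K] [NeZero n] (r : Fin n → K) {p : K[X]}
    (i j : Fin n) (h : aeval (spectral r) p * coord r i * coord r j = 0) : p = 0 := by
  refine p.eq_zero_of_infinite_isRoot ?_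
  refine ((Set.toFinite {r i, r j}).infinite_compl).mono fun c hc => ?_
  simp only [Set.mem_compl_iff, Set.mem_insert_iff, Set.mem_singleton_iff, not_or] at hc
  obtain ⟨f, hf, hfc⟩ := exists_curve_point r c
  have hne : ∀ k, c ≠ r k → f (coord r k) ≠ 0 := fun k hk h0 => by
    have := hfc k
    rw [h0, zero_pow two_ne_zero, eq_comm, map_eq_zero, sub_eq_zero] at this
    exact hk this
  have := congrArg f h
  rw [map_mul, map_mul, map_zero, ← aeval_algHom_apply, hf, aeval_algebraMap_apply] at this
  have h1 := (mul_eq_zero.1 ((mul_eq_zero.1 this).resolve_right (hne j hc.2))).resolve_right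
    (hne i hc.1)
  rw [map_eq_zero] at h1
  simpa [IsRoot] using h1

theorem eq_zero_of_aeval_spectral_mul_coord [Infinite K] [NeZero n] (r : Fin n → K) {p : K[X]}
    (i : Fin n) (h : aeval (spectral r) p * coord r i = 0) : p = 0 :=
  eq_zero_of_aeval_spectral_mul r i i (by rw [h, zero_mul])

end CurveRing

/-! ### The quasigrading and the generation of L(n) -/

section Components

open Polynomial

variable {K : Type*} [Field K] {n : ℕ} [NeZero n] (r : Fin n → K)

/-- The element `Q_i^{2k+1} = (E_{i,n+1} + E_{n+1,i}) ⊗ λ^k λ_i`. -/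
def oddElement (k : ℕ) (i : Fin n) : Mat n (CurveRing r) :=
  boost i (spectral r ^ k * coord r i)

/-- The element `Q_{ij}^{2k+2} = (E_{i,j} - E_{j,i}) ⊗ λ^k λ_i λ_j`. -/
def evenElement (k : ℕ) (i j : Fin n) : Mat n (CurveRing r) :=
  rotation i j (spectral r ^ k * coord r i * coord r j)

/-- The pairs of indices `i < j`. -/
abbrev IncreasingPair (n : ℕ) := {p : Fin n × Fin n // p.1 < p.2}

theorem component_odd (k : ℕ) :
    component r (2 * k + 1) = Submodule.span K (Set.range (oddElement r k)) := by
  simp only [component, even_two_mul, if_true, Nat.mul_div_cancel_left k two_pos]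
  rfl

theorem component_even (k : ℕ) : component r (2 * k + 2)
    = Submodule.span K (Set.range fun p : IncreasingPair n => evenElement r k p.1.1 p.1.2) := by
  have h1 : ¬Even (2 * k + 1) := by simp
  have h2 : (2 * k + 1) / 2 = k := by omega
  rw [component, if_neg h1, h2]
  congr 1
  ext x
  constructor
  · rintro ⟨i, j, hij, rfl⟩
    exact ⟨⟨(i, j), hij⟩, rfl⟩
  · rintro ⟨p, rfl⟩
    exact ⟨p.1.1, p.1.2, p.2, rfl⟩

theorem oddElement_mem (k : ℕ) (i : Fin n) : oddElement r k i ∈ component r (2 * k + 1) := by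
  rw [component_odd]
  exact Submodule.subset_span ⟨i, rfl⟩

theorem evenElement_swap (k : ℕ) (i j : Fin n) :
    evenElement r k i j = -evenElement r k j i := by
  rw [evenElement, evenElement, rotation_swap, mul_right_comm]

theorem evenElement_mem (k : ℕ) (i j : Fin n) :
    evenElement r k i j ∈ component r (2 * k + 2) := by
  rw [component_even]
  rcases lt_trichotomy i j with h | rfl | h
  · exact Submodule.subset_span ⟨⟨(i, j), h⟩, rfl⟩
  · rw [evenElement, rotation_self]
    exact zero_mem _
  · rw [evenElement_swap]
    exact neg_mem (Submodule.subset_span ⟨⟨(j, i), h⟩, rfl⟩)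

theorem lie_odd_odd (a b : ℕ) (i j : Fin n) :
    ⁅oddElement r a i, oddElement r b j⁆ = evenElement r (a + b) i j := by
  rw [oddElement, oddElement, lie_boost_boost, evenElement]
  congr 1
  ring

/-- Replacing λ_j² by λ - r_j is the source of the two degrees in the quasigrading. -/
theorem boost_mul_coord_sq (a b : ℕ) (i j : Fin n) :
    boost i (spectral r ^ a * coord r i * coord r j * (spectral r ^ b * coord r j))
      = oddElement r (a + b + 1) i - r j • oddElement r (a + b) i := by
  rw [sub_eq_add_neg, ← neg_smul, oddElement, oddElement, ← boost_smul, ← boost_add,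
    Algebra.smul_def, map_neg]
  congr 1
  linear_combination spectral r ^ (a + b) * coord r i * coord_sq r j

theorem lie_even_odd (a b : ℕ) (i j k : Fin n) :
    ⁅evenElement r a i j, oddElement r b k⁆
      = (if j = k then oddElement r (a + b + 1) i - r j • oddElement r (a + b) i else 0)
        - if i = k then oddElement r (a + b + 1) j - r i • oddElement r (a + b) j else 0 := by
  rw [evenElement, oddElement, lie_rotation_boost]
  congr 1
  · split_ifs with h
    · subst h
      exact boost_mul_coord_sq r a b i j
    · rfl
  · split_ifs with h
    · subst h
      rw [mul_right_comm (spectral r ^ a)]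
      exact boost_mul_coord_sq r a b j i
    · rfl

theorem rotation_mul_coord_sq (a b : ℕ) (i j l : Fin n) {q : CurveRing r}
    (hq : q = spectral r ^ (a + b) * coord r j ^ 2 * coord r i * coord r l) :
    rotation i l q = evenElement r (a + b + 1) i l - r j • evenElement r (a + b) i l := by
  rw [sub_eq_add_neg, ← neg_smul, evenElement, evenElement, ← rotation_smul, ← rotation_add,
    Algebra.smul_def, map_neg, hq]
  congr 1
  linear_combination spectral r ^ (a + b) * coord r i * coord r l * coord_sq r j

theorem lie_even_even_mem (a b : ℕ) (i j k l : Fin n) :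
    ⁅evenElement r a i j, evenElement r b k l⁆
      ∈ component r (2 * (a + b + 1) + 2) ⊔ component r (2 * (a + b) + 2) := by
  -- Each Kronecker term of the bracket contracts one common index, here j, and so carries the
  -- factor λ_j² = λ - r_j.
  have key : ∀ (i j l : Fin n) (q : CurveRing r),
      q = spectral r ^ (a + b) * coord r j ^ 2 * coord r i * coord r l →
      rotation i l q ∈ component r (2 * (a + b + 1) + 2) ⊔ component r (2 * (a + b) + 2) := by
    intro i j l q hq
    rw [rotation_mul_coord_sq r a b i j l hq]
    exact sub_mem (Submodule.mem_sup_left (evenElement_mem r _ _ _))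
      (Submodule.mem_sup_right (Submodule.smul_mem _ _ (evenElement_mem r _ _ _)))
  rw [evenElement, evenElement, lie_rotation_rotation]
  refine add_mem (sub_mem (sub_mem ?_ ?_) ?_) ?_ <;> split_ifs with h
  any_goals exact zero_mem _
  all_goals subst h
  · exact key i j l _ (by ring)
  · exact key i j k _ (by ring)
  · exact key j i l _ (by ring)
  · exact key j i k _ (by ring)

theorem lie_mem_of_mem_span {V : Type*} [LieRing V] [LieAlgebra K V] {s t : Set V}
    {P : Submodule K V} (h : ∀ x ∈ s, ∀ y ∈ t, ⁅x, y⁆ ∈ P) {x y : V}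
    (hx : x ∈ Submodule.span K s) (hy : y ∈ Submodule.span K t) : ⁅x, y⁆ ∈ P := by
  induction hx, hy using Submodule.span_induction₂ with
  | mem_mem u v hu hv => exact h u hu v hv
  | zero_left v hv => simp
  | zero_right u hu => simp
  | add_left u₁ u₂ v hu₁ hu₂ hv huv₁ huv₂ => simpa using add_mem huv₁ huv₂
  | add_right u v₁ v₂ hu hv₁ hv₂ huv₁ huv₂ => simpa using add_mem huv₁ huv₂
  | smul_left t u v hu hv huv => simpa using Submodule.smul_mem _ _ huv
  | smul_right t u v hu hv huv => simpa using Submodule.smul_mem _ _ huv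

theorem lie_component_even_odd (a b : ℕ) {x y : Mat n (CurveRing r)}
    (hx : x ∈ component r (2 * a + 2)) (hy : y ∈ component r (2 * b + 1)) :
    ⁅x, y⁆ ∈ component r (2 * (a + b + 1) + 1) ⊔ component r (2 * (a + b) + 1) := by
  rw [component_even] at hx
  rw [component_odd] at hy
  refine lie_mem_of_mem_span ?_ hx hy
  rintro _ ⟨p, rfl⟩ _ ⟨k, rfl⟩
  have key : ∀ i j, oddElement r (a + b + 1) i - r j • oddElement r (a + b) i
      ∈ component r (2 * (a + b + 1) + 1) ⊔ component r (2 * (a + b) + 1) := fun i j =>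
    sub_mem (Submodule.mem_sup_left (oddElement_mem r _ _))
      (Submodule.mem_sup_right (Submodule.smul_mem _ _ (oddElement_mem r _ _)))
  rw [lie_even_odd]
  refine sub_mem ?_ ?_ <;> split_ifs
  any_goals exact zero_mem _
  all_goals exact key _ _

theorem lie_component_mem {i j : ℕ} (hi : 1 ≤ i) (hj : 1 ≤ j) {x y : Mat n (CurveRing r)}
    (hx : x ∈ component r i) (hy : y ∈ component r j) :
    ⁅x, y⁆ ∈ component r (i + j) ⊔ component r (i + j - 2) := by
  -- Two odd degrees contract no index, so their bracket lies in the top component alone; in the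
  -- other cases the degree drop by two appears.
  obtain ⟨a, rfl | rfl⟩ : ∃ a, i = 2 * a + 1 ∨ i = 2 * a + 2 := ⟨(i - 1) / 2, by omega⟩ <;>
  obtain ⟨b, rfl | rfl⟩ : ∃ b, j = 2 * b + 1 ∨ j = 2 * b + 2 := ⟨(j - 1) / 2, by omega⟩
  · refine Submodule.mem_sup_left ?_
    rw [show 2 * a + 1 + (2 * b + 1) = 2 * (a + b) + 2 by ring]
    rw [component_odd] at hx hy
    refine lie_mem_of_mem_span ?_ hx hy
    rintro _ ⟨i, rfl⟩ _ ⟨j, rfl⟩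
    rw [lie_odd_odd]
    exact evenElement_mem r _ _ _
  · rw [← lie_skew, show 2 * a + 1 + (2 * b + 2) = 2 * (b + a + 1) + 1 by ring,
      show 2 * (b + a + 1) + 1 - 2 = 2 * (b + a) + 1 by omega]
    exact neg_mem (lie_component_even_odd r b a hy hx)
  · rw [show 2 * a + 2 + (2 * b + 1) = 2 * (a + b + 1) + 1 by ring,
      show 2 * (a + b + 1) + 1 - 2 = 2 * (a + b) + 1 by omega]
    exact lie_component_even_odd r a b hx hy
  · rw [show 2 * a + 2 + (2 * b + 2) = 2 * (a + b + 1) + 2 by ring,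
      show 2 * (a + b + 1) + 2 - 2 = 2 * (a + b) + 2 by omega]
    rw [component_even] at hx hy
    refine lie_mem_of_mem_span ?_ hx hy
    rintro _ ⟨p, rfl⟩ _ ⟨q, rfl⟩
    exact lie_even_even_mem r a b _ _ _ _

theorem oddElement_zero (i : Fin n) : oddElement r 0 i = boost i (coord r i) := by
  rw [oddElement, pow_zero, one_mul]

theorem evenElement_mem_algL_of_odd {k : ℕ} (h : ∀ i, oddElement r k i ∈ algL r) (i j : Fin n) :
    evenElement r k i j ∈ algL r := by
  have := (algL r).lie_mem (h i) (boost_coord_mem_algL r j)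
  rwa [← oddElement_zero, lie_odd_odd] at this

/-- For j ≠ i the bracket of Q_{ij}^{2k+2} with Q_j is Q_i^{2k+3} - r_j Q_i^{2k+1}; the lower term
is already in L(n), so induction climbs two degrees at a time. -/
theorem oddElement_mem_algL (hn : 2 ≤ n) (k : ℕ) (i : Fin n) : oddElement r k i ∈ algL r := by
  induction k generalizing i with
  | zero =>
    rw [oddElement_zero]
    exact boost_coord_mem_algL r i
  | succ k ih =>
    have : Nontrivial (Fin n) := Fin.nontrivial_iff_two_le.2 hn
    obtain ⟨j, hj⟩ := exists_ne i
    have := (algL r).lie_mem (evenElement_mem_algL_of_odd r ih i j) (boost_coord_mem_algL r j)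
    rw [← oddElement_zero, lie_even_odd, if_pos rfl, if_neg hj.symm, sub_zero] at this
    have := add_mem this ((algL r).smul_mem (r j) (ih i))
    rwa [add_zero, sub_add_cancel] at this

theorem component_le_algL (hn : 2 ≤ n) (k : ℕ) : component r k ≤ (algL r).toSubmodule := by
  rcases k with _ | k
  · exact bot_le
  obtain ⟨a, rfl | rfl⟩ : ∃ a, k = 2 * a ∨ k = 2 * a + 1 := ⟨k / 2, by omega⟩
  · rw [component_odd, Submodule.span_le]
    rintro _ ⟨i, rfl⟩
    exact oddElement_mem_algL r hn a i
  · rw [component_even, Submodule.span_le]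
    rintro _ ⟨p, rfl⟩
    exact evenElement_mem_algL_of_odd r (oddElement_mem_algL r hn a) _ _

theorem lie_mem_iSup_component {x y : Mat n (CurveRing r)} (hx : x ∈ ⨆ k, component r k)
    (hy : y ∈ ⨆ k, component r k) : ⁅x, y⁆ ∈ ⨆ k, component r k := by
  rw [Submodule.iSup_eq_span] at hx hy
  refine lie_mem_of_mem_span ?_ hx hy
  intro x hx y hy
  obtain ⟨i, hx⟩ := Set.mem_iUnion.1 hx
  obtain ⟨j, hy⟩ := Set.mem_iUnion.1 hy
  rcases i.eq_zero_or_pos with rfl | hi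
  · rw [show x = 0 from hx, zero_lie]
    exact zero_mem _
  rcases j.eq_zero_or_pos with rfl | hj
  · rw [show y = 0 from hy, lie_zero]
    exact zero_mem _
  exact (sup_le (le_iSup (component r) _) (le_iSup (component r) _) :
    _ ≤ ⨆ k, component r k) (lie_component_mem r hi hj hx hy)

/-- The sum of the components is closed under the bracket and contains the generators, which lie in
degree 1. -/
theorem iSup_component (hn : 2 ≤ n) : ⨆ k, component r k = (algL r).toSubmodule := by
  refine le_antisymm (iSup_le (component_le_algL r hn)) ?_
  let L : LieSubalgebra K (Mat n (CurveRing r)) :=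
    { (⨆ k, component r k : Submodule K (Mat n (CurveRing r))) with
      lie_mem' := fun hx hy => lie_mem_iSup_component r hx hy }
  have : algL r ≤ L := by
    refine LieSubalgebra.lieSpan_le.2 ?_
    rintro _ ⟨i, rfl⟩
    change boost i (coord r i) ∈ ⨆ k, component r k
    rw [← oddElement_zero]
    exact Submodule.mem_iSup_of_mem 1 (oddElement_mem r 0 i)
  exact this

end Components
end LandauLifshitz

namespace LandauLifshitz

section Orthogonal

theorem algL_le_orthogonalSubalgebra {K : Type*} [Field K] {n : ℕ} (r : Fin n → K) :
    algL r ≤ orthogonalSubalgebra K (CurveRing r) n := by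
  refine LieSubalgebra.lieSpan_le.2 ?_
  rintro _ ⟨i, rfl⟩
  exact boost_mem_so' i _

end Orthogonal

/-! ### Linear independence, directness and dimensions -/

section Independence

open Polynomial

variable {K : Type*} [Field K] {n : ℕ} [NeZero n] (r : Fin n → K)

/-- The linear map sending `(f, g)` to the sum of the `(E_{i,n+1} + E_{n+1,i}) ⊗ f_i(λ) λ_i` and the
`(E_{i,j} - E_{j,i}) ⊗ g_{ij}(λ) λ_i λ_j`. -/
def polynomialCombination :
    (Fin n → K[X]) × (IncreasingPair n → K[X]) →ₗ[K] Mat n (CurveRing r) where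
  toFun f := ∑ i, boost i (aeval (spectral r) (f.1 i) * coord r i)
    + ∑ p : IncreasingPair n, rotation p.1.1 p.1.2
        (aeval (spectral r) (f.2 p) * coord r p.1.1 * coord r p.1.2)
  map_add' f g := by
    simp only [Prod.fst_add, Prod.snd_add, Pi.add_apply, map_add, add_mul, boost_add,
      rotation_add, Finset.sum_add_distrib]
    abel
  map_smul' c f := by
    simp only [Prod.smul_fst, Prod.smul_snd, Pi.smul_apply, map_smul, smul_mul_assoc, boost_smul,
      rotation_smul, RingHom.id_apply, smul_add, Finset.smul_sum]

theorem polynomialCombination_apply (f : (Fin n → K[X]) × (IncreasingPair n → K[X])) :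
    polynomialCombination r f = ∑ i, boost i (aeval (spectral r) (f.1 i) * coord r i)
    + ∑ p : IncreasingPair n, rotation p.1.1 p.1.2
        (aeval (spectral r) (f.2 p) * coord r p.1.1 * coord r p.1.2) := rfl

/-- The matrix entries at (i, n+1) and at (i, j) with i < j isolate f_i(λ) λ_i and g_{ij}(λ) λ_i
λ_j, and each vanishes only for the zero polynomial. -/
theorem ker_polynomialCombination [Infinite K] :
    LinearMap.ker (polynomialCombination r) = ⊥ := by
  classical
  refine LinearMap.ker_eq_bot'.2 fun f hf => ?_
  rw [polynomialCombination_apply] at hf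
  refine Prod.ext (funext fun i => ?_) (funext fun p => ?_)
  · have := congrFun (congrFun hf (Sum.inl i)) (Sum.inr ())
    rw [Matrix.add_apply, Matrix.sum_apply, Matrix.sum_apply] at this
    simp only [boost_apply_inl_inr, rotation_apply_inl_inr, Finset.sum_ite_eq', Finset.mem_univ,
      if_true, Finset.sum_const_zero, add_zero] at this
    exact eq_zero_of_aeval_spectral_mul_coord r i this
  · have := congrFun (congrFun hf (Sum.inl p.1.1)) (Sum.inl p.1.2)
    rw [Matrix.add_apply, Matrix.sum_apply, Matrix.sum_apply, Finset.sum_eq_single p] at this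
    · rw [rotation_apply_of_lt p.2 p.2, if_pos ⟨rfl, rfl⟩] at this
      simp only [boost_apply_inl_inl, Finset.sum_const_zero, zero_add] at this
      exact eq_zero_of_aeval_spectral_mul r _ _ this
    · intro q _ hq
      rw [rotation_apply_of_lt q.2 p.2, if_neg]
      exact fun h => hq (Subtype.ext (Prod.ext h.1 h.2))
    · exact fun h => absurd (Finset.mem_univ p) h

/-- The elements `Q_i^{2k+1}` and `Q_{ij}^{2k+2}`, `i < j`. -/
def homogeneousElement : (Σ _ : Fin n, ℕ) ⊕ (Σ _ : IncreasingPair n, ℕ) → Mat n (CurveRing r) :=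
  Sum.elim (fun x => oddElement r x.2 x.1) fun x => evenElement r x.2 x.1.1.1 x.1.1.2

/-- The degrees of the elements `Q_i^{2k+1}` and `Q_{ij}^{2k+2}`. -/
def homogeneousDegree : (Σ _ : Fin n, ℕ) ⊕ (Σ _ : IncreasingPair n, ℕ) → ℕ :=
  Sum.elim (fun x => 2 * x.2 + 1) fun x => 2 * x.2 + 2

/-- The family is the image of the monomial basis of the polynomial tuples under an injective linear
map. -/
theorem linearIndependent_homogeneousElement [Infinite K] :
    LinearIndependent K (homogeneousElement r) := by
  classical
  have h := (((Pi.basis fun _ : Fin n => Polynomial.basisMonomials K).prod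
    (Pi.basis fun _ : IncreasingPair n => Polynomial.basisMonomials K)).linearIndependent).map'
    (polynomialCombination r) (ker_polynomialCombination r)
  refine (congrArg (fun v => LinearIndependent K v) (funext fun x => ?_)).mpr h
  have h1 : ∀ k, aeval (spectral r) (monomial k (1 : K)) = spectral r ^ k := fun k => by
    simp
  rcases x with ⟨i, k⟩ | ⟨p, k⟩
  · simp only [homogeneousElement, Function.comp_apply, Module.Basis.prod_apply, Sum.elim_inl,
      LinearMap.coe_inl, Pi.basis_apply, polynomialCombination_apply, coe_basisMonomials,
      Pi.zero_apply, map_zero, zero_mul]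
    rw [Finset.sum_eq_single i, Pi.single_eq_same, h1]
    · simp [oddElement, rotation]
    · intro j _ hj
      simp [Pi.single_eq_of_ne hj, boost]
    · simp
  · simp only [homogeneousElement, Function.comp_apply, Module.Basis.prod_apply, Sum.elim_inr,
      LinearMap.coe_inr, Pi.basis_apply, polynomialCombination_apply, coe_basisMonomials,
      Pi.zero_apply, map_zero, zero_mul]
    rw [Finset.sum_eq_single p, Pi.single_eq_same, h1]
    · simp [evenElement, boost]
    · intro j _ hj
      simp [Pi.single_eq_of_ne hj, rotation]
    · simp

theorem component_eq_span_homogeneousElement (d : ℕ) :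
    component r d
      = Submodule.span K (homogeneousElement r '' (homogeneousDegree ⁻¹' {d})) := by
  rcases d with _ | d
  · have : (homogeneousDegree (n := n)) ⁻¹' {0} = ∅ := by
      ext x
      rcases x with x | x <;> simp [homogeneousDegree]
    rw [this, Set.image_empty, Submodule.span_empty]
    rfl
  obtain ⟨k, rfl | rfl⟩ : ∃ a, d = 2 * a ∨ d = 2 * a + 1 := ⟨d / 2, by omega⟩
  · rw [component_odd]
    congr 1
    ext x
    constructor
    · rintro ⟨i, rfl⟩
      exact ⟨Sum.inl ⟨i, k⟩, rfl, rfl⟩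
    · rintro ⟨⟨i, l⟩ | ⟨p, l⟩, h, rfl⟩ <;>
        simp only [homogeneousDegree, Set.mem_preimage, Set.mem_singleton_iff, Sum.elim_inl,
          Sum.elim_inr] at h
      · obtain rfl : l = k := by omega
        exact ⟨i, rfl⟩
      · omega
  · rw [component_even]
    congr 1
    ext x
    constructor
    · rintro ⟨p, rfl⟩
      exact ⟨Sum.inr ⟨p, k⟩, rfl, rfl⟩
    · rintro ⟨⟨i, l⟩ | ⟨p, l⟩, h, rfl⟩ <;>
        simp only [homogeneousDegree, Set.mem_preimage, Set.mem_singleton_iff, Sum.elim_inl,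
          Sum.elim_inr] at h
      · omega
      · obtain rfl : l = k := by omega
        exact ⟨p, rfl⟩

/-- Different degrees use disjoint parts of one linearly independent family, and such parts span
disjoint subspaces. -/
theorem iSupIndep_component [Infinite K] : iSupIndep (component r) := by
  intro d
  have h : ⨆ j, ⨆ _ : j ≠ d, component r j
      ≤ Submodule.span K (homogeneousElement r '' (homogeneousDegree ⁻¹' {d}ᶜ)) := by
    refine iSup₂_le fun j hj => ?_
    rw [component_eq_span_homogeneousElement]
    exact Submodule.span_mono (Set.image_mono (Set.preimage_mono (by simpa using hj.symm)))
  refine Disjoint.mono_right h ?_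
  rw [component_eq_span_homogeneousElement]
  refine (linearIndependent_homogeneousElement r).disjoint_span_image ?_
  exact Disjoint.preimage _ disjoint_compl_right

theorem card_increasingPair (n : ℕ) : Fintype.card (IncreasingPair (n + 1)) = (n + 1) * n / 2 := by
  rw [Fintype.card_subtype, Finset.card_filter, Fintype.sum_prod_type, Finset.sum_comm]
  -- Pairs are counted by their larger element.
  have h : ∀ j : Fin (n + 1), (∑ i : Fin (n + 1), if i < j then 1 else 0) = (j : ℕ) := fun j => by
    rw [← Finset.card_filter]
    exact (congrArg Finset.card (by ext; simp)).trans (Fin.card_Iio j)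
  refine (Finset.sum_congr rfl fun j _ => h j).trans ?_
  rw [Fin.sum_univ_eq_sum_range fun i => i, Finset.sum_range_id, Nat.add_sub_cancel]

theorem finrank_component_odd [Infinite K] (k : ℕ) :
    Module.finrank K (component r (2 * k + 1)) = n := by
  rw [component_odd]
  have h := (linearIndependent_homogeneousElement r).comp
    (fun i : Fin n => Sum.inl ⟨i, k⟩) fun i j hij => by simpa using hij
  exact (finrank_span_eq_card h).trans (Fintype.card_fin n)

theorem finrank_component_even [Infinite K] (k : ℕ) :
    Module.finrank K (component r (2 * k + 2)) = Fintype.card (IncreasingPair n) := by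
  rw [component_even]
  have h := (linearIndependent_homogeneousElement r).comp
    (fun p : IncreasingPair n => Sum.inr ⟨p, k⟩) fun i j hij => by simpa using hij
  exact finrank_span_eq_card h

theorem not_finiteDimensional_algL [Infinite K] (hn : 2 ≤ n) : ¬FiniteDimensional K (algL r) := by
  intro _
  have h := (linearIndependent_homogeneousElement r).comp
    (fun k : ℕ => Sum.inl ⟨0, k⟩) fun i j hij => by simpa using hij
  have h' : LinearIndependent K fun k : ℕ =>
      (⟨oddElement r k 0, oddElement_mem_algL r hn k 0⟩ : algL r) :=
    LinearIndependent.of_comp (algL r).toSubmodule.subtype h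
  exact Module.Finite.not_linearIndependent_of_infinite _ h'

end Independence

/-! ### M and N take values in L(n) and depend on u, u_x, u_xx -/

section Membership

variable {K A : Type*} [Field K] [CommRing A] [Algebra K A] {m : ℕ}

theorem dependsOnlyBelow_mul {d : ℕ} {X Y : JetSeries m K} (hX : DependsOnlyBelow d X)
    (hY : DependsOnlyBelow d Y) : DependsOnlyBelow d (X * Y) := by
  have := hX.scale hY
  rw [scale_eq_map_mul] at this
  simpa using this

theorem dependsOnlyBelow_dot {d l : ℕ} {a b : Fin l → JetSeries m K}
    (ha : ∀ i, DependsOnlyBelow d (a i)) (hb : ∀ i, DependsOnlyBelow d (b i)) :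
    DependsOnlyBelow d (dot a b) := by
  intro γ hγ
  rw [coef_eq_coeff, dot, map_sum]
  exact Finset.sum_eq_zero fun i _ => dependsOnlyBelow_mul (ha i) (hb i) γ hγ

theorem dependsOnlyBelow_smul {S V : Type*} [Semiring S] [AddCommMonoid V] [Module S V] {d : ℕ} (c : S)
    {X : JetSeries m V} (hX : DependsOnlyBelow d X) : DependsOnlyBelow d (c • X) := fun γ hγ => by
  change c • coef γ X = 0
  rw [hX γ hγ, smul_zero]

theorem dependsOnlyBelow_zcrN [CharZero K] (r : Fin (m + 1) → K) (l : Fin (m + 1) → A) :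
    DependsOnlyBelow 3 (zcrN r l) := by
  have hM := dependsOnlyBelow_zcrM (K := K) l
  have hS := dependsOnlyBelow_sphereVec (K := K) (m := m)
  refine DependsOnlyBelow.add (DependsOnlyBelow.add (DependsOnlyBelow.add hM.totalDx.totalDx ?_)
    (dependsOnlyBelow_smul _ (hM.mono (by norm_num))))
    (DependsOnlyBelow.scale (DependsOnlyBelow.add ?_ ?_)
      (hM.mono (by norm_num)))
  · exact (hM.totalDx.mono (by norm_num)).bracket (hM.mono (by norm_num))
  · refine dependsOnlyBelow_smul _ (DependsOnlyBelow.mono (d := 1) (by norm_num) ?_)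
    exact dependsOnlyBelow_dot hS fun i => dependsOnlyBelow_smul _ (hS i)
  · refine dependsOnlyBelow_smul _ (DependsOnlyBelow.mono (d := 2) (by norm_num) ?_)
    exact dependsOnlyBelow_dot (fun i => (hS i).totalDx) fun i => (hS i).totalDx

theorem coef_zcrM_mem (L : LieSubalgebra K (Mat (m + 1) A)) {l : Fin (m + 1) → A}
    (hL : ∀ i, boost i (l i) ∈ L) (γ : (Fin m × ℕ) →₀ ℕ) : coef γ (zcrM K l) ∈ L := by
  rw [coef_zcrM]
  exact sum_mem fun i _ => L.smul_mem _ (hL i)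

/-- Only the summand λM leaves the K-linear operations and brackets, since λ lies in A; `hL'`
supplies it. In L(n) this is the presence of the degree 3 elements. -/
theorem coef_zcrN_mem (L : LieSubalgebra K (Mat (m + 1) A)) {l : Fin (m + 1) → A}
    (r : Fin (m + 1) → K) (hL : ∀ i, boost i (l i) ∈ L)
    (hL' : ∀ i, boost i ((algebraMap K A (r 0) + l 0 ^ 2) * l i) ∈ L) (γ : (Fin m × ℕ) →₀ ℕ) :
    coef γ (zcrN r l) ∈ L := by
  have hM := coef_zcrM_mem L hL
  have hDM : ∀ γ, coef γ (totalDx K (zcrM K l)) ∈ L := coef_totalDx_mem L.toSubmodule hM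
  refine add_mem (add_mem (add_mem (coef_totalDx_mem L.toSubmodule hDM γ)
    (coef_bracket_mem L hDM hM γ)) ?_) (coef_scale_mem L.toSubmodule _ hM γ)
  change (algebraMap K A (r 0) + l 0 ^ 2) • coef γ (zcrM K l) ∈ L
  rw [coef_zcrM, Finset.smul_sum]
  refine sum_mem fun i _ => ?_
  have := L.smul_mem (coef γ (sphereVec K m i)) (hL' i)
  rw [smul_comm]
  rwa [← smul_eq_mul, show boost i ((algebraMap K A (r 0) + l 0 ^ 2) • l i)
    = (algebraMap K A (r 0) + l 0 ^ 2) • (boost i (l i) : Mat (m + 1) A) by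
      simp only [boost, ← Matrix.smul_single, smul_add]] at this

theorem coef_zcrM_coord_mem (r : Fin (m + 1) → K) (γ : (Fin m × ℕ) →₀ ℕ) :
    coef γ (zcrM K (coord r)) ∈ algL r :=
  coef_zcrM_mem (algL r) (boost_coord_mem_algL r) γ

theorem coef_zcrN_coord_mem (r : Fin (m + 1) → K) (hn : 2 ≤ m + 1) (γ : (Fin m × ℕ) →₀ ℕ) :
    coef γ (zcrN r (coord r)) ∈ algL r := by
  refine coef_zcrN_mem (algL r) r (boost_coord_mem_algL r) (fun i => ?_) γ
  have := oddElement_mem_algL r hn 1 i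
  rwa [oddElement, pow_one, spectral,
    add_comm (coord r 0 ^ 2)] at this

end Membership

/-! ### The universal property of the WE algebra -/

section Epimorphism

variable {K V : Type*} [Field K] [LieRing V] [LieAlgebra K V] {m d : ℕ}

theorem dependsOnlyBelow_seriesOf {V : Type*} [Zero V] (A : Exponents m d → V) :
    DependsOnlyBelow d (seriesOf A) := fun _ hγ => dif_neg hγ

theorem mapCoef_seriesOf {V W : Type*} [AddCommGroup V] [Module K V] [AddCommGroup W] [Module K W]
    (g : V →ₗ[K] W) (A : Exponents m d → V) {X : JetSeries m W} (hX : DependsOnlyBelow d X)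
    (h : ∀ α, g (A α) = coef α.1 X) : mapCoef g (seriesOf A) = X := by
  ext γ
  rw [coef_mapCoef]
  by_cases hγ : γ ∈ Exponents m d
  · rw [← h ⟨γ, hγ⟩]
    exact congrArg g (dif_pos hγ)
  · rw [hX γ hγ, dependsOnlyBelow_seriesOf A γ hγ, map_zero]

/-- A homomorphism of Lie algebras induced on the quotient by an ideal contained in the kernel. -/
def lieQuotientLift {L : Type*} [LieRing L] [LieAlgebra K L] (I : LieIdeal K L) (f : L →ₗ⁅K⁆ V)
    (h : I ≤ f.ker) : L ⧸ I →ₗ⁅K⁆ V :=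
  { I.toSubmodule.liftQ (f : L →ₗ[K] V) h with
    map_lie' := by
      intro x y
      obtain ⟨x, rfl⟩ := LieSubmodule.Quotient.surjective_mk' I x
      obtain ⟨y, rfl⟩ := LieSubmodule.Quotient.surjective_mk' I y
      exact f.map_lie x y }

/-- The universal property of the Wahlquist-Estabrook algebra, for a zero-curvature representation
with coefficients in a Lie subalgebra. -/
theorem exists_hom_of_zcr (F : Fin m → JetSeries m K) (L : LieSubalgebra K V)
    {X T : JetSeries m V} (hX : DependsOnlyBelow d X) (hT : DependsOnlyBelow d T)
    (hXL : ∀ γ, coef γ X ∈ L) (hTL : ∀ γ, coef γ T ∈ L) (h : curvature F X T = 0) :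
    ∃ φ : WEAlgebra d F →ₗ⁅K⁆ L, (∀ α, (φ (genA F α) : V) = coef α.1 X) ∧
      ∀ β, (φ (genB F β) : V) = coef β.1 T := by
  let f : FreeAlg K m d →ₗ⁅K⁆ L := FreeLieAlgebra.lift K
    (Sum.elim (fun α => ⟨coef α.1 X, hXL _⟩) fun β => ⟨coef β.1 T, hTL _⟩)
  have hf : ∀ x, f (FreeLieAlgebra.of K x)
      = Sum.elim (fun α => ⟨coef α.1 X, hXL _⟩) (fun β => ⟨coef β.1 T, hTL _⟩) x :=
    FreeLieAlgebra.lift_of_apply _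
  let g : FreeAlg K m d →ₗ⁅K⁆ V := L.incl.comp f
  have hgX := mapCoef_seriesOf (g : FreeAlg K m d →ₗ[K] V)
    (fun α => FreeLieAlgebra.of K (Sum.inl α)) hX fun α => congrArg Subtype.val (hf (Sum.inl α))
  have hgT := mapCoef_seriesOf (g : FreeAlg K m d →ₗ[K] V)
    (fun β => FreeLieAlgebra.of K (Sum.inr β)) hT fun β => congrArg Subtype.val (hf (Sum.inr β))
  have hker : relationIdeal d F ≤ f.ker := by
    refine LieSubmodule.lieSpan_le.2 ?_
    rintro _ ⟨γ, rfl⟩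
    -- The defining relations are the coefficients of the generic curvature; `g` sends them to the
    -- coefficients of the curvature of (X, T), which vanish.
    have hc := curvature_mapCoef F g (dependsOnlyBelow_seriesOf fun α : Exponents m d =>
      FreeLieAlgebra.of K (Sum.inl α)) (seriesOf fun β : Exponents m d =>
      FreeLieAlgebra.of K (Sum.inr β))
    rw [hgX, hgT, h] at hc
    exact LieHom.mem_ker.2 (Subtype.ext (congrArg (coef γ) hc).symm)
  refine ⟨lieQuotientLift _ f hker, fun α => ?_, fun β => ?_⟩
  · exact congrArg Subtype.val (hf (Sum.inl α))
  · exact congrArg Subtype.val (hf (Sum.inr β))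

end Epimorphism

/-! ### Surjectivity onto L(n) -/

section Surjectivity

variable {K : Type*} [Field K] {m : ℕ}

theorem constantCoeff_deltaInv : MvPowerSeries.constantCoeff (deltaInv K m) = 1 := by
  have := congrArg MvPowerSeries.constantCoeff (deltaInv_mul (K := K) (m := m))
  rwa [map_mul, constantCoeff_dot_uVec, mul_one, map_one] at this

theorem coef_zero_sphereVec (i : Fin (m + 1)) :
    coef 0 (sphereVec K m i) = if i = Fin.last m then 1 else 0 := by
  rw [coef_eq_coeff, MvPowerSeries.coeff_zero_eq_constantCoeff_apply]
  induction i using Fin.lastCases with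
  | last =>
    rw [sphereVec_last, map_sub, map_mul, constantCoeff_deltaInv, map_one, map_ofNat, if_pos rfl]
    norm_num
  | cast i =>
    rw [sphereVec_castSucc, if_neg (Fin.castSucc_lt_last i).ne]
    simp [uVec, jet]

theorem coef_single_eq (X : JetSeries m K) (s : Fin m × ℕ) : coef (Finsupp.single s 1) X
    = MvPowerSeries.constantCoeff (MvPowerSeries.pderiv K s X) := by
  rw [← MvPowerSeries.coeff_zero_eq_constantCoeff_apply, MvPowerSeries.coeff_pderiv, coef_eq_coeff]
  simp

theorem constantCoeff_pderiv_deltaInv (s : Fin m × ℕ) :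
    MvPowerSeries.constantCoeff (MvPowerSeries.pderiv K s (deltaInv K m)) = 0 := by
  rw [derivation_deltaInv]
  simp [dot, uVec, jet]

theorem coef_single_sphereVec (i : Fin (m + 1)) (j : Fin m) :
    coef (Finsupp.single (j, 0) 1) (sphereVec K m i) = if i = j.castSucc then 2 else 0 := by
  rw [coef_single_eq]
  induction i using Fin.lastCases with
  | last =>
    rw [sphereVec_last, if_neg (Fin.castSucc_lt_last j).ne']
    simp [derivation_two, constantCoeff_pderiv_deltaInv]
  | cast i =>
    rw [sphereVec_castSucc]
    by_cases h : i = j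
    · subst h
      simp [derivation_two, constantCoeff_pderiv_deltaInv, constantCoeff_deltaInv, uVec, jet,
        map_ofNat]
    · have : MvPowerSeries.pderiv K (j, 0) (uVec K m 0 i) = 0 :=
        MvPowerSeries.pderiv_X_of_ne (by simpa using h)
      rw [if_neg (by simpa using h)]
      simp [derivation_two, constantCoeff_pderiv_deltaInv, this]

/-- At u = 0 the vector S is the pole (0, …, 0, 1), and its linear part is 2u^j in the other
coordinates. So M has constant coefficient Q_n and coefficient 2 Q_j at u^j. -/
theorem boost_mem_of_coef_zcrM_mem [CharZero K] {A : Type*} [CommRing A] [Algebra K A] (l : Fin (m + 1) → A)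
    (L : Submodule K (Mat (m + 1) A)) (h : ∀ α : Exponents m 3, coef α.1 (zcrM K l) ∈ L)
    (i : Fin (m + 1)) : boost i (l i) ∈ L := by
  induction i using Fin.lastCases with
  | last =>
    have := h ⟨0, fun s hs => by simp at hs⟩
    rw [coef_zcrM] at this
    simpa [coef_zero_sphereVec, ite_smul] using this
  | cast j =>
    have := h ⟨Finsupp.single (j, 0) 1, fun s hs => by
      rw [Finsupp.mem_support_iff, Finsupp.single_apply_ne_zero] at hs
      simp [hs.1]⟩
    rw [coef_zcrM] at this
    simp only [coef_single_sphereVec, ite_smul, zero_smul, Finset.sum_ite_eq', Finset.mem_univ,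
      if_true] at this
    exact (L.smul_mem_iff two_ne_zero).1 this

theorem exists_epimorphism [CharZero K] (r : Fin (m + 1) → K) (hn : 2 ≤ m + 1) :
    ∃ φ : WEAlgebra 3 (rhs r) →ₗ⁅K⁆ algL r,
      Function.Surjective φ ∧
      (∀ α : Exponents m 3,
        (φ (genA (rhs r) α) : Mat (m + 1) (CurveRing r)) = coef α.1 (zcrM K (coord r))) ∧
      (∀ β : Exponents m 3,
        (φ (genB (rhs r) β) : Mat (m + 1) (CurveRing r)) = coef β.1 (zcrN r (coord r))) := by
  obtain ⟨φ, hA, hB⟩ := exists_hom_of_zcr (rhs r) (algL r)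
    ((dependsOnlyBelow_zcrM (K := K) (coord r)).mono (e := 3) (by norm_num))
    (dependsOnlyBelow_zcrN r (coord r)) (coef_zcrM_coord_mem r) (coef_zcrN_coord_mem r hn)
    (curvature_zcr r (onCurve_coord r))
  refine ⟨φ, ?_, hA, hB⟩
  -- The image is compared with L(n) inside the full matrix algebra, where L(n) is defined as the
  -- span of its generators.
  have hle : algL r ≤ φ.range.map (algL r).incl := by
    refine LieSubalgebra.lieSpan_le.2 ?_
    rintro _ ⟨i, rfl⟩
    refine boost_mem_of_coef_zcrM_mem (coord r) (φ.range.map (algL r).incl).toSubmodule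
      (fun α => ?_) i
    exact ⟨φ (genA (rhs r) α), ⟨genA (rhs r) α, rfl⟩, hA α⟩
  intro x
  obtain ⟨_, ⟨z, rfl⟩, hz⟩ := hle x.2
  exact ⟨z, Subtype.ext hz⟩

end Surjectivity
end LandauLifshitz

end

/-- Here `n = m + 1` is the dimension of the system, and `𝕜` is `ℂ` or `ℝ`. -/
theorem theorem1 {𝕜 : Type*} [RCLike 𝕜] (m : ℕ) (hn : 3 ≤ m + 1)
    (r : Fin (m + 1) → 𝕜) (hr : Function.Injective r) :
    -- the evolutionary system for `u` is the Landau-Lifshitz system for the unit vector `S`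
    (dot (sphereVec 𝕜 m) (sphereVec 𝕜 m) = 1 ∧
      ∀ i, totalDt (rhs r) (sphereVec 𝕜 m i) = sphereRHS r i) ∧
    -- `L(n)` consists of `so_{n,1}`-valued functions on the curve
    (∀ x ∈ algL r, x ∈ LieAlgebra.Orthogonal.so' (Fin (m + 1)) Unit (CurveRing r)) ∧
    -- `L(n)` is infinite-dimensional and quasigraded
    ¬ FiniteDimensional 𝕜 (algL r) ∧
    iSupIndep (component r) ∧
    ⨆ k, component r k = (algL r).toSubmodule ∧
    (∀ i j, 1 ≤ i → 1 ≤ j → ∀ x ∈ component r i, ∀ y ∈ component r j,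
      ⁅x, y⁆ ∈ component r (i + j) ⊔ component r (i + j - 2)) ∧
    (∀ k, 1 ≤ k → Module.finrank 𝕜 (component r (2 * k - 1)) = m + 1 ∧
      Module.finrank 𝕜 (component r (2 * k)) = (m + 1) * m / 2) ∧
    -- at every point of the curve, `M` and `N` form an `so_{n,1}`-valued
    -- zero-curvature representation of the system
    (∀ l : Fin (m + 1) → 𝕜, OnCurve r l →
      (∀ γ, coef γ (zcrM 𝕜 l) ∈ LieAlgebra.Orthogonal.so' (Fin (m + 1)) Unit 𝕜 ∧
        coef γ (zcrN r l) ∈ LieAlgebra.Orthogonal.so' (Fin (m + 1)) Unit 𝕜) ∧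
      curvature (rhs r) (zcrM 𝕜 l) (zcrN r l) = 0) ∧
    -- with the coordinate functions of the curve as parameters, `M` and `N` form a
    -- zero-curvature representation in the variables `u, u_x, u_xx` with values in `L(n)`
    (OnCurve r (coord r) ∧
      DependsOnlyBelow 3 (zcrM 𝕜 (coord r)) ∧ DependsOnlyBelow 3 (zcrN r (coord r)) ∧
      (∀ γ, coef γ (zcrM 𝕜 (coord r)) ∈ algL r ∧ coef γ (zcrN r (coord r)) ∈ algL r) ∧
      curvature (rhs r) (zcrM 𝕜 (coord r)) (zcrN r (coord r)) = 0) ∧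
    -- it determines an epimorphism from the Wahlquist-Estabrook algebra onto `L(n)`
    ∃ φ : WEAlgebra 3 (rhs r) →ₗ⁅𝕜⁆ algL r,
      Function.Surjective φ ∧
      (∀ α : Exponents m 3,
        (φ (genA (rhs r) α) : Mat (m + 1) (CurveRing r)) = coef α.1 (zcrM 𝕜 (coord r))) ∧
      (∀ β : Exponents m 3,
        (φ (genB (rhs r) β) : Mat (m + 1) (CurveRing r)) = coef β.1 (zcrN r (coord r))) := by
  have hn' : 2 ≤ m + 1 := by omega
  refine ⟨⟨dot_sphereVec_self, totalDt_rhs_sphereVec r⟩,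
    fun x hx => algL_le_orthogonalSubalgebra r hx, not_finiteDimensional_algL r hn',
    iSupIndep_component r, iSup_component r hn',
    fun i j hi hj x hx y hy => lie_component_mem r hi hj hx hy, fun k hk => ?_,
    fun l hl => ⟨fun γ => ?_, curvature_zcr r hl⟩,
    ⟨onCurve_coord r, (dependsOnlyBelow_zcrM (coord r)).mono (by norm_num),
      dependsOnlyBelow_zcrN r (coord r),
      fun γ => ⟨coef_zcrM_coord_mem r γ, coef_zcrN_coord_mem r hn' γ⟩,
      curvature_zcr r (onCurve_coord r)⟩,
    exists_epimorphism r hn'⟩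
  -- After the shift k ↦ k + 1, the degree 2(k + 1) - 1 is 2k + 1 by definition, so the odd case
  -- needs no rewriting.
  · obtain ⟨k, rfl⟩ := Nat.exists_eq_add_of_le' hk
    refine ⟨finrank_component_odd r k, ?_⟩
    rw [mul_add, mul_one, finrank_component_even, card_increasingPair]
  · exact ⟨coef_zcrM_mem (orthogonalSubalgebra 𝕜 𝕜 (m + 1)) (fun i => boost_mem_so' i _) γ,
      coef_zcrN_mem (orthogonalSubalgebra 𝕜 𝕜 (m + 1)) r (fun i => boost_mem_so' i _)
        (fun i => boost_mem_so' i _) γ⟩
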